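/- Let $M$ be a finite-dimensional smooth manifold without boundary. Let $\mathfrak h=\bigoplus_{q=0}^{\dim M}\Omega^q(M)$ be the space of smooth differential forms on $M$, graded so that a $q$-form has degree $-q-1$. Let $\phi\in\Omega^1(M)$ be closed, i.e. $d\phi=0$. For $t\in\mathbb R$, let $[\cdot,\cdot]_{t,\phi}$ be the bilinear bracket on $\mathfrak h$ determined by $$[\alpha,\beta]_{t,\phi}=(-1)^a\,d(\alpha\wedge\beta)+\tfrac{a+b+2}{2}\,\alpha\wedge t\phi\wedge\beta\qquad(\alpha\in\Omega^a(M),\ \beta\in\Omega^b(M)).$$ Let $\mathfrak g_0'=\{X\in\mathfrak X(M)\mid L_X\phi=0\}$, where $\mathfrak X(M)$ is the space of smooth vector fields and $L_X=\iota_X d+d\,\iota_X$ is the Lie derivative. Here a Lie superalgebra is a real vector space $L=\bigoplus_{i\in\mathbb Z}L_i$ with a bilinear bracket satisfying, for $x\in L_i$, $y\in L_j$, $z\in L_k$: $[x,y]\in L_{i+j}$; $[x,y]+(-1)^{ij}[y,x]=0$; and $(-1)^{ik}[[x,y],z]+(-1)^{ji}[[y,z],x]+(-1)^{kj}[[z,x],y]=0$.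 Theorem. $\mathfrak g_0'$ is a Lie subalgebra of $\mathfrak X(M)$ with the Jacobi–Lie bracket. For every $t\in\mathbb R$, both $(\mathfrak h,[\cdot,\cdot]_{t,\phi})$ and $\mathfrak h\oplus\mathfrak g_0'$ are Lie superalgebras, where $\mathfrak g_0'$ is placed in degree $0$ and the bracket on $\mathfrak h\oplus\mathfrak g_0'$ is the bilinear one given by $[\cdot,\cdot]_{t,\phi}$ on $\mathfrak h$, by the Jacobi–Lie bracket on $\mathfrak g_0'$, and by $$[X,\beta]=-[\beta,X]=L_X\beta\qquad(X\in\mathfrak g_0',\ \beta\in\mathfrak h).$$ Moreover, $\mathfrak h\oplus\mathfrak g_0'$ is an extension of $\mathfrak g_0'$ by $\mathfrak h$: the inclusion and the projection form a short exact sequence $0\to\mathfrak h\to\mathfrak h\oplus\mathfrak g_0'\to\mathfrak g_0'\to 0$ of degree-preserving homomorphisms of Lie superalgebras. -/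

import Mathlib

set_option linter.unusedSectionVars false
set_option linter.style.haveILetI false
open scoped Manifold ContDiff Topology

namespace DeformedForms

section Pointwise

variable {V W : Type*} [AddCommGroup V] [Module ℝ V] [TopologicalSpace V]
  [AddCommGroup W] [Module ℝ W] [TopologicalSpace W] {a b : ℕ}

/-- The wedge product of alternating forms on a vector space,
`(α ∧ β)(v) = ∑ sign σ · α(v ∘ σ ∘ inl) · β(v ∘ σ ∘ inr)`, the sum being over the
`(a, b)`-shuffles `σ`. -/
noncomputable def wedgeAlg (α : V [⋀^Fin a]→ₗ[ℝ] ℝ) (β : V [⋀^Fin b]→ₗ[ℝ] ℝ) :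
    V [⋀^Fin (a + b)]→ₗ[ℝ] ℝ :=
  ((LinearMap.mul' ℝ ℝ).compAlternatingMap (α.domCoprod β)).domDomCongr finSumFinEquiv

theorem wedgeAlg_apply (α : V [⋀^Fin a]→ₗ[ℝ] ℝ) (β : V [⋀^Fin b]→ₗ[ℝ] ℝ) (v : Fin (a + b) → V) :
    wedgeAlg α β v = ∑ σ : Equiv.Perm.ModSumCongr (Fin a) (Fin b),
      ((Equiv.Perm.sign σ.out : ℤ) : ℝ) *
        (α (fun i => v (finSumFinEquiv (σ.out (Sum.inl i)))) *
          β (fun j => v (finSumFinEquiv (σ.out (Sum.inr j))))) := by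
  simp only [wedgeAlg, AlternatingMap.domDomCongr_apply, LinearMap.compAlternatingMap_apply,
    AlternatingMap.domCoprod_apply, sum_apply, map_sum]
  refine Finset.sum_congr rfl fun σ _ => ?_
  conv_lhs => rw [← Quotient.out_eq' σ]
  rw [AlternatingMap.domCoprod.summand_mk'']
  rcases Int.units_eq_one_or (Equiv.Perm.sign (Quotient.out σ)) with h | h <;>
    simp [h, Function.comp_def]

/-- The wedge product of continuous alternating forms. -/
noncomputable def wedge (α : V [⋀^Fin a]→L[ℝ] ℝ) (β : V [⋀^Fin b]→L[ℝ] ℝ) :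
    V [⋀^Fin (a + b)]→L[ℝ] ℝ :=
  { wedgeAlg α.toAlternatingMap β.toAlternatingMap with
    cont := by
      change Continuous fun v => wedgeAlg α.toAlternatingMap β.toAlternatingMap v
      simp only [wedgeAlg_apply]
      refine continuous_finsetSum _ fun σ _ => continuous_const.mul (Continuous.mul ?_ ?_)
      · exact α.cont.comp (continuous_pi fun i => continuous_apply _)
      · exact β.cont.comp (continuous_pi fun i => continuous_apply _) }

theorem wedge_apply (α : V [⋀^Fin a]→L[ℝ] ℝ) (β : V [⋀^Fin b]→L[ℝ] ℝ) (v : Fin (a + b) → V) :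
    wedge α β v = ∑ σ : Equiv.Perm.ModSumCongr (Fin a) (Fin b),
      ((Equiv.Perm.sign σ.out : ℤ) : ℝ) *
        (α (fun i => v (finSumFinEquiv (σ.out (Sum.inl i)))) *
          β (fun j => v (finSumFinEquiv (σ.out (Sum.inr j))))) :=
  wedgeAlg_apply _ _ v

theorem wedge_add_left (α α' : V [⋀^Fin a]→L[ℝ] ℝ) (β : V [⋀^Fin b]→L[ℝ] ℝ) :
    wedge (α + α') β = wedge α β + wedge α' β := by
  ext v; simp [wedge_apply, add_mul, mul_add, Finset.sum_add_distrib]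

theorem wedge_add_right (α : V [⋀^Fin a]→L[ℝ] ℝ) (β β' : V [⋀^Fin b]→L[ℝ] ℝ) :
    wedge α (β + β') = wedge α β + wedge α β' := by
  ext v; simp [wedge_apply, mul_add, Finset.sum_add_distrib]

theorem wedge_smul_left (c : ℝ) (α : V [⋀^Fin a]→L[ℝ] ℝ) (β : V [⋀^Fin b]→L[ℝ] ℝ) :
    wedge (c • α) β = c • wedge α β := by
  ext v
  simp only [wedge_apply, ContinuousAlternatingMap.smul_apply, smul_eq_mul, Finset.mul_sum]
  exact Finset.sum_congr rfl fun _ _ => by ring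

theorem wedge_smul_right (c : ℝ) (α : V [⋀^Fin a]→L[ℝ] ℝ) (β : V [⋀^Fin b]→L[ℝ] ℝ) :
    wedge α (c • β) = c • wedge α β := by
  ext v
  simp only [wedge_apply, ContinuousAlternatingMap.smul_apply, smul_eq_mul, Finset.mul_sum]
  exact Finset.sum_congr rfl fun _ _ => by ring

theorem wedge_compContinuousLinearMap (α : V [⋀^Fin a]→L[ℝ] ℝ) (β : V [⋀^Fin b]→L[ℝ] ℝ)
    (f : W →L[ℝ] V) :
    (wedge α β).compContinuousLinearMap f =
      wedge (α.compContinuousLinearMap f) (β.compContinuousLinearMap f) := by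
  ext v
  simp [wedge_apply, Function.comp_def]

end Pointwise

section Normed
variable {E : Type*} [NormedAddCommGroup E] [NormedSpace ℝ E] {a b : ℕ}

theorem norm_wedge_le (α : E [⋀^Fin a]→L[ℝ] ℝ) (β : E [⋀^Fin b]→L[ℝ] ℝ) :
    ‖wedge α β‖ ≤ (Fintype.card (Equiv.Perm.ModSumCongr (Fin a) (Fin b)) : ℝ) * ‖α‖ * ‖β‖ := by
  refine ContinuousAlternatingMap.opNorm_le_bound _ (by positivity) fun v => ?_
  rw [wedge_apply]
  refine (norm_sum_le _ _).trans ?_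
  have key : ∀ σ : Equiv.Perm.ModSumCongr (Fin a) (Fin b),
      ‖((Equiv.Perm.sign σ.out : ℤ) : ℝ) *
        (α (fun i => v (finSumFinEquiv (σ.out (Sum.inl i)))) *
          β (fun j => v (finSumFinEquiv (σ.out (Sum.inr j)))))‖ ≤ ‖α‖ * ‖β‖ * ∏ i, ‖v i‖ := by
    intro σ
    have hs : ‖((Equiv.Perm.sign σ.out : ℤ) : ℝ)‖ = 1 := by
      rcases Int.units_eq_one_or (Equiv.Perm.sign (Quotient.out σ)) with h | h <;> simp [h]
    have hp : ∏ i, ‖v i‖ = (∏ i, ‖v (finSumFinEquiv (σ.out (Sum.inl i)))‖) *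
        ∏ j, ‖v (finSumFinEquiv (σ.out (Sum.inr j)))‖ := by
      rw [← Fintype.prod_sum_type (fun s => ‖v (finSumFinEquiv (σ.out s))‖)]
      exact (Equiv.prod_comp (σ.out.trans finSumFinEquiv) (fun i => ‖v i‖)).symm
    rw [norm_mul, hs, one_mul, norm_mul, hp]
    calc _ ≤ (‖α‖ * ∏ i, ‖v (finSumFinEquiv (σ.out (Sum.inl i)))‖) *
          (‖β‖ * ∏ j, ‖v (finSumFinEquiv (σ.out (Sum.inr j)))‖) :=
          mul_le_mul (α.le_opNorm _) (β.le_opNorm _) (norm_nonneg _) (by positivity)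
      _ = _ := by ring
  refine (Finset.sum_le_sum fun σ _ => key σ).trans ?_
  simp [mul_assoc]

/-- The wedge product as a continuous bilinear map. -/
noncomputable def wedgeCLM (a b : ℕ) :
    (E [⋀^Fin a]→L[ℝ] ℝ) →L[ℝ] (E [⋀^Fin b]→L[ℝ] ℝ) →L[ℝ] (E [⋀^Fin (a + b)]→L[ℝ] ℝ) :=
  LinearMap.mkContinuous₂
    (LinearMap.mk₂ ℝ wedge wedge_add_left wedge_smul_left wedge_add_right wedge_smul_right)
    (Fintype.card (Equiv.Perm.ModSumCongr (Fin a) (Fin b)))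
    norm_wedge_le

theorem contDiff_wedgeCLM (a b : ℕ) : ContDiff ℝ ∞ (fun α => wedgeCLM (E := E) a b α) :=
  ContinuousLinearMap.contDiff (𝕜 := ℝ) (E := E [⋀^Fin a]→L[ℝ] ℝ)
    (F := (E [⋀^Fin b]→L[ℝ] ℝ) →L[ℝ] (E [⋀^Fin (a + b)]→L[ℝ] ℝ)) (wedgeCLM a b)

theorem contDiff_curryLeft (k : ℕ) :
    ContDiff ℝ ∞ (fun α : E [⋀^Fin (k + 1)]→L[ℝ] ℝ => α.curryLeft) :=
  ContinuousLinearMap.contDiff (𝕜 := ℝ) (E := E [⋀^Fin (k + 1)]→L[ℝ] ℝ)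
    (F := E →L[ℝ] (E [⋀^Fin k]→L[ℝ] ℝ))
    (ContinuousAlternatingMap.curryLeftLI (𝕜 := ℝ) (E := E) (F := ℝ) (n := k)).toContinuousLinearMap

end Normed

section Manifold

variable {E : Type*} [NormedAddCommGroup E] [NormedSpace ℝ E] {M : Type*} [TopologicalSpace M]
  [ChartedSpace E M] {k : ℕ}

variable (E M) in
/-- Fields of alternating `k`-forms on the tangent spaces of `M`, not necessarily smooth. -/
abbrev RawForm (k : ℕ) : Type _ := Π x : M, TangentSpace 𝓘(ℝ, E) x [⋀^Fin k]→L[ℝ] ℝ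

/-- The expression of `α` in the chart around `x₀`: its pullback to the model space under the
inverse of the chart (meaningful on the target of the chart). -/
noncomputable def inChart (x₀ : M) (α : RawForm E M k) (y : E) : E [⋀^Fin k]→L[ℝ] ℝ :=
  (α ((chartAt E x₀).symm y)).compContinuousLinearMap
    (mfderiv 𝓘(ℝ, E) 𝓘(ℝ, E) (chartAt E x₀).symm y)

variable (E M) in
/-- A field of `k`-forms is smooth if its expressions in the charts are. -/
noncomputable def smoothForms (k : ℕ) : Submodule ℝ (RawForm E M k) where
  carrier := {α | ∀ x₀ : M, ContDiffOn ℝ ∞ (inChart x₀ α) (chartAt E x₀).target}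
  add_mem' := fun h h' x₀ => (h x₀).add (h' x₀)
  zero_mem' := fun _ => contDiffOn_const (c := (0 : E [⋀^Fin k]→L[ℝ] ℝ))
  smul_mem' := fun c _ h x₀ => (h x₀).const_smul c

theorem mem_smoothForms {α : RawForm E M k} : α ∈ smoothForms E M k ↔
    ∀ x₀ : M, ContDiffOn ℝ ∞ (inChart x₀ α) (chartAt E x₀).target := Iff.rfl

/-- The exterior derivative, computed at `x` in the chart around `x`; for smooth forms any other chart
gives the same result, see `inChart_rawExtDeriv`. -/
noncomputable def rawExtDeriv (α : RawForm E M k) : RawForm E M (k + 1) := fun x =>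
  (extDeriv (inChart x α) (chartAt E x x)).compContinuousLinearMap
    (mfderiv 𝓘(ℝ, E) 𝓘(ℝ, E) (chartAt E x) x)

/-- The interior product `(ι_X α)(v₁, …, v_k) = α(X, v₁, …, v_k)`. -/
noncomputable def rawInner (X : Π x : M, TangentSpace 𝓘(ℝ, E) x) (α : RawForm E M (k + 1)) :
    RawForm E M k := fun x =>
  ContinuousAlternatingMap.curryLeft (E := E) (α x) (X x)

variable [IsManifold 𝓘(ℝ, E) ∞ M]

theorem mdiff_chart (x₀ : M) {x : M} (hx : x ∈ (chartAt E x₀).source) :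
    MDifferentiableAt 𝓘(ℝ, E) 𝓘(ℝ, E) (chartAt E x₀) x :=
  mdifferentiableAt_atlas (chart_mem_atlas E x₀) hx

theorem mdiff_chart_symm (x₀ : M) {y : E} (hy : y ∈ (chartAt E x₀).target) :
    MDifferentiableAt 𝓘(ℝ, E) 𝓘(ℝ, E) (chartAt E x₀).symm y :=
  mdifferentiableAt_atlas_symm (chart_mem_atlas E x₀) hy

theorem inChart_rawExtDeriv {α : RawForm E M k} (hα : α ∈ smoothForms E M k) (x₀ : M) {y : E}
    (hy : y ∈ (chartAt E x₀).target) :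
    inChart x₀ (rawExtDeriv α) y = extDeriv (inChart x₀ α) y := by
  set p := (chartAt E x₀).symm y with hp
  set e := chartAt E p with he
  set τ : E → E := fun z => e ((chartAt E x₀).symm z) with hτ
  have hU : ∀ᶠ z in 𝓝 y, z ∈ (chartAt E x₀).target ∧ (chartAt E x₀).symm z ∈ e.source := by
    refine Filter.Eventually.and ((chartAt E x₀).open_target.mem_nhds hy) ?_
    exact ((chartAt E x₀).continuousAt_symm hy).eventually
      (e.open_source.mem_nhds (mem_chart_source E p))
  have hmf : ∀ z, z ∈ (chartAt E x₀).target ∧ (chartAt E x₀).symm z ∈ e.source →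
      fderiv ℝ τ z = (mfderiv 𝓘(ℝ, E) 𝓘(ℝ, E) e ((chartAt E x₀).symm z)).comp
        (mfderiv 𝓘(ℝ, E) 𝓘(ℝ, E) (chartAt E x₀).symm z) := by
    intro z hz
    rw [← mfderiv_eq_fderiv]
    exact mfderiv_comp z (mdiff_chart p hz.2) (mdiff_chart_symm x₀ hz.1)
  have heval : ∀ (q r : M) (v w : Fin k → E), q = r → v = w →
      (show E [⋀^Fin k]→L[ℝ] ℝ from α q) v = (show E [⋀^Fin k]→L[ℝ] ℝ from α r) w := by
    rintro q _ v _ rfl rfl; rfl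
  have hloc : inChart x₀ α =ᶠ[𝓝 y]
      fun z => (inChart p α (τ z)).compContinuousLinearMap (fderiv ℝ τ z) := by
    filter_upwards [hU] with z hz
    have h1 : e.symm (τ z) = (chartAt E x₀).symm z := e.left_inv hz.2
    have h2 : (mfderiv 𝓘(ℝ, E) 𝓘(ℝ, E) e.symm (e ((chartAt E x₀).symm z))).comp
        (mfderiv 𝓘(ℝ, E) 𝓘(ℝ, E) e ((chartAt E x₀).symm z)) = ContinuousLinearMap.id ℝ _ :=
      (mdifferentiable_of_mem_atlas (chart_mem_atlas E p)).symm_comp_deriv hz.2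
    rw [hmf z hz]
    ext v
    refine heval _ _ _ _ h1.symm (funext fun i => ?_)
    exact (DFunLike.congr_fun h2
      (mfderiv 𝓘(ℝ, E) 𝓘(ℝ, E) (chartAt E x₀).symm z (v i))).symm
  have hτs : ContDiffAt ℝ ∞ τ y := by
    rw [← contMDiffAt_iff_contDiffAt]
    exact (contMDiffAt_of_mem_maximalAtlas (IsManifold.chart_mem_maximalAtlas p)
        (mem_chart_source E p)).comp y
      (contMDiffAt_symm_of_mem_maximalAtlas (IsManifold.chart_mem_maximalAtlas x₀) hy)
  have hd : DifferentiableAt ℝ (inChart p α) (τ y) :=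
    ((mem_smoothForms.1 hα p).contDiffAt (e.open_target.mem_nhds (mem_chart_target E p))).differentiableAt
      (by simp)
  rw [hloc.extDeriv_eq, extDeriv_pullback hd hτs (by rw [minSmoothness_of_isRCLikeNormedField]; exact ENat.LEInfty.out), hmf y ⟨hy, mem_chart_source E p⟩]
  rfl

theorem rawExtDeriv_mem {α : RawForm E M k} (hα : α ∈ smoothForms E M k) :
    rawExtDeriv α ∈ smoothForms E M (k + 1) := by
  refine mem_smoothForms.2 fun x₀ => ?_
  have h : ContDiffOn ℝ ∞ (extDeriv (inChart x₀ α)) (chartAt E x₀).target := by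
    intro y hy
    have h1 : ContDiffAt ℝ ∞ (inChart x₀ α) y :=
      (mem_smoothForms.1 hα x₀).contDiffAt ((chartAt E x₀).open_target.mem_nhds hy)
    have h2 : ContDiffAt ℝ ∞ (fderiv ℝ (inChart x₀ α)) y := h1.fderiv_right (by simp)
    exact ((ContinuousAlternatingMap.alternatizeUncurryFinCLM ℝ E
      ℝ (n := k)).contDiff.contDiffAt.comp y h2).contDiffWithinAt
  exact h.congr fun y hy => inChart_rawExtDeriv hα x₀ hy

theorem rawWedge_mem {a b : ℕ} {α : RawForm E M a} {β : RawForm E M b}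
    (hα : α ∈ smoothForms E M a) (hβ : β ∈ smoothForms E M b) :
    (fun x => wedge (α x) (β x)) ∈ smoothForms E M (a + b) := by
  refine mem_smoothForms.2 fun x₀ => ?_
  have h : ContDiffOn ℝ ∞ (fun y => wedgeCLM a b (inChart x₀ α y) (inChart x₀ β y))
      (chartAt E x₀).target :=
    ContDiffOn.clm_apply (f := fun y => wedgeCLM a b (inChart x₀ α y))
      (ContDiff.comp_contDiffOn (contDiff_wedgeCLM a b) (mem_smoothForms.1 hα x₀))
      (mem_smoothForms.1 hβ x₀)
  exact h.congr fun y _ => wedge_compContinuousLinearMap _ _ _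

/-- The smooth vector fields on `M`. -/
abbrev VectorFields (E M : Type*) [NormedAddCommGroup E] [NormedSpace ℝ E] [TopologicalSpace M]
    [ChartedSpace E M] [IsManifold 𝓘(ℝ, E) ∞ M] : Type _ :=
  ContMDiffSection 𝓘(ℝ, E) E ∞ (TangentSpace 𝓘(ℝ, E) : M → Type _)

theorem rawInner_mem [CompleteSpace E] (X : VectorFields E M) {α : RawForm E M (k + 1)}
    (hα : α ∈ smoothForms E M (k + 1)) : rawInner X α ∈ smoothForms E M k := by
  refine mem_smoothForms.2 fun x₀ => ?_
  set Y : E → E := VectorField.mpullback 𝓘(ℝ, E) 𝓘(ℝ, E) (chartAt E x₀).symm X with hY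
  have hinv : ∀ y ∈ (chartAt E x₀).target,
      (mfderiv 𝓘(ℝ, E) 𝓘(ℝ, E) (chartAt E x₀).symm y).IsInvertible := fun y hy =>
    ⟨((mdifferentiable_of_mem_atlas (chart_mem_atlas E x₀)).symm).mfderiv hy, rfl⟩
  have hYs : ContDiffOn ℝ ∞ Y (chartAt E x₀).target := fun y hy => by
    have : ContMDiffAt 𝓘(ℝ, E) 𝓘(ℝ, E).tangent ∞
        (fun z => (⟨z, Y z⟩ : TangentBundle 𝓘(ℝ, E) E)) y :=
      ContMDiffAt.mpullback_vectorField_preimage (n := ∞) (X.contMDiff _)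
        (contMDiffAt_symm_of_mem_maximalAtlas (IsManifold.chart_mem_maximalAtlas x₀) hy)
        (hinv y hy) (by simp)
    exact (contMDiffAt_vectorSpace_iff_contDiffAt.1 this).contDiffWithinAt
  have h : ContDiffOn ℝ ∞ (fun y => ContinuousAlternatingMap.curryLeft (inChart x₀ α y) (Y y))
      (chartAt E x₀).target :=
    ContDiffOn.clm_apply (f := fun y => ContinuousAlternatingMap.curryLeft (inChart x₀ α y))
      (ContDiff.comp_contDiffOn (contDiff_curryLeft k) (mem_smoothForms.1 hα x₀)) hYs
  refine h.congr fun y hy => ?_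
  ext v
  have hXY : mfderiv 𝓘(ℝ, E) 𝓘(ℝ, E) (chartAt E x₀).symm y (Y y) = X ((chartAt E x₀).symm y) :=
    (hinv y hy).self_apply_inverse _
  refine congrArg (show E [⋀^Fin (k + 1)]→L[ℝ] ℝ from α ((chartAt E x₀).symm y)) (funext fun i => ?_)
  refine Fin.cases ?_ (fun j => ?_) i
  · exact hXY.symm
  · rfl

variable (E M) in
/-- The space `Ω^k(M)` of smooth `k`-forms. -/
def Form (k : ℕ) : Type _ := smoothForms E M k

noncomputable instance : AddCommGroup (Form E M k) :=
  inferInstanceAs (AddCommGroup (smoothForms E M k))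

noncomputable instance : Module ℝ (Form E M k) :=
  inferInstanceAs (Module ℝ (smoothForms E M k))

theorem differentiableAt_inChart (α : Form E M k) (x : M) :
    DifferentiableAt ℝ (inChart x α.1) (chartAt E x x) :=
  ((mem_smoothForms.1 α.2 x).contDiffAt
    ((chartAt E x).open_target.mem_nhds (mem_chart_target E x))).differentiableAt (by simp)

/-- The exterior derivative `d : Ω^k(M) → Ω^{k+1}(M)`. -/
noncomputable def extDer : Form E M k →ₗ[ℝ] Form E M (k + 1) where
  toFun α := ⟨rawExtDeriv α.1, rawExtDeriv_mem α.2⟩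
  map_add' α β := by
    refine Subtype.ext (funext fun x => ?_)
    have h := extDeriv_add (differentiableAt_inChart α x) (differentiableAt_inChart β x)
    exact congrArg (fun η : E [⋀^Fin (k + 1)]→L[ℝ] ℝ => η.compContinuousLinearMap
      (mfderiv 𝓘(ℝ, E) 𝓘(ℝ, E) (chartAt E x) x)) h
  map_smul' c α := by
    refine Subtype.ext (funext fun x => ?_)
    have h := extDeriv_smul c (inChart x α.1) (x := chartAt E x x)
    exact congrArg (fun η : E [⋀^Fin (k + 1)]→L[ℝ] ℝ => η.compContinuousLinearMap
      (mfderiv 𝓘(ℝ, E) 𝓘(ℝ, E) (chartAt E x) x)) h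

/-- The wedge product of forms. -/
noncomputable def formWedge {a b : ℕ} : Form E M a →ₗ[ℝ] Form E M b →ₗ[ℝ] Form E M (a + b) :=
  LinearMap.mk₂ ℝ (fun α β => ⟨fun x => wedge (α.1 x) (β.1 x), rawWedge_mem α.2 β.2⟩)
    (fun _ _ _ => Subtype.ext (funext fun _ => wedge_add_left _ _ _))
    (fun _ _ _ => Subtype.ext (funext fun _ => wedge_smul_left _ _ _))
    (fun _ _ _ => Subtype.ext (funext fun _ => wedge_add_right _ _ _))
    (fun _ _ _ => Subtype.ext (funext fun _ => wedge_smul_right _ _ _))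

variable [FiniteDimensional ℝ E]

/-- The interior product `ι_X : Ω^{k+1}(M) → Ω^k(M)`. -/
noncomputable def interiorProd : VectorFields E M →ₗ[ℝ] Form E M (k + 1) →ₗ[ℝ] Form E M k :=
  haveI : CompleteSpace E := FiniteDimensional.complete ℝ E
  LinearMap.mk₂ ℝ (fun X α => ⟨rawInner X α.1, rawInner_mem X α.2⟩)
    (fun X Y α => Subtype.ext (funext fun x => map_add
      (ContinuousAlternatingMap.curryLeft (E := E) (α.1 x)) (X x) (Y x)))
    (fun c X α => Subtype.ext (funext fun x => map_smul
      (ContinuousAlternatingMap.curryLeft (E := E) (α.1 x)) c (X x)))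
    (fun _ _ _ => rfl)
    (fun _ _ _ => rfl)

/-- The Lie derivative `L_X = ι_X ∘ d + d ∘ ι_X` on `k`-forms (with `ι_X = 0` on functions). -/
noncomputable def lieDer : (k : ℕ) → VectorFields E M →ₗ[ℝ] Form E M k →ₗ[ℝ] Form E M k
  | 0 => interiorProd.compl₂ extDer
  | _ + 1 => interiorProd.compl₂ extDer + interiorProd.compr₂ extDer

/-- The Jacobi–Lie bracket of vector fields. -/
noncomputable instance : LieRing (VectorFields E M) where
  bracket X Y := ⟨VectorField.mlieBracket 𝓘(ℝ, E) X Y, by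
    have : CompleteSpace E := FiniteDimensional.complete ℝ E
    have : IsManifold 𝓘(ℝ, E) (minSmoothness ℝ 2) M := by
      rw [minSmoothness_of_isRCLikeNormedField]; infer_instance
    have : IsManifold 𝓘(ℝ, E) (∞ + 1) M := inferInstanceAs (IsManifold 𝓘(ℝ, E) ∞ M)
    exact ContDiff.mlieBracket_vectorField (n := ⊤) (m := ⊤) X.contMDiff Y.contMDiff (by simp)⟩
  add_lie X Y Z := ContMDiffSection.ext fun x =>
    VectorField.mlieBracket_add_left X.mdifferentiableAt Y.mdifferentiableAt
  lie_add X Y Z := ContMDiffSection.ext fun x =>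
    VectorField.mlieBracket_add_right Y.mdifferentiableAt Z.mdifferentiableAt
  lie_self X := ContMDiffSection.ext fun x =>
    congrFun (VectorField.mlieBracket_self (V := (X : Π x : M, TangentSpace 𝓘(ℝ, E) x))) x
  leibniz_lie X Y Z := ContMDiffSection.ext fun x => by
    have : CompleteSpace E := FiniteDimensional.complete ℝ E
    have : IsManifold 𝓘(ℝ, E) (minSmoothness ℝ 3) M := by
      rw [minSmoothness_of_isRCLikeNormedField]; infer_instance
    have h2 : minSmoothness ℝ 2 ≤ ∞ := by
      rw [minSmoothness_of_isRCLikeNormedField]; exact ENat.LEInfty.out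
    exact VectorField.leibniz_identity_mlieBracket_apply
      ((X.contMDiff x).of_le h2) ((Y.contMDiff x).of_le h2) ((Z.contMDiff x).of_le h2)

noncomputable instance : LieAlgebra ℝ (VectorFields E M) where
  lie_smul _ _ Y := ContMDiffSection.ext fun _ =>
    VectorField.mlieBracket_const_smul_right Y.mdifferentiableAt

variable (E M) in
/-- `𝔥`, the space of all forms: the sum of the `Ω^k(M)`, of which those with `k > dim M` vanish. -/
abbrev AllForms : Type _ := DirectSum ℕ fun k => Form E M k

theorem form_eq_zero (hk : Module.finrank ℝ E < k) (α : Form E M k) : α = 0 := by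
  refine Subtype.ext (funext fun x => ContinuousAlternatingMap.ext fun v => ?_)
  refine (show E [⋀^Fin k]→L[ℝ] ℝ from α.1 x).toAlternatingMap.map_linearDependent v fun h => ?_
  have := h.fintype_card_le_finrank
  simp only [Fintype.card_fin] at this
  exact absurd (hk.trans_le this) (lt_irrefl _)

open DirectSum in
/-- The deformed standard bracket on homogeneous forms, for `α` of degree `a` and `β` of degree `b`:
`(-1)^a d(α ∧ β) + (a + b + 2)/2 · α ∧ tφ ∧ β`. -/
noncomputable def formBracketHom (φ : Form E M 1) (t : ℝ) (a b : ℕ) :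
    Form E M a →ₗ[ℝ] Form E M b →ₗ[ℝ] AllForms E M :=
  (-1 : ℝ) ^ a • formWedge.compr₂ (lof ℝ ℕ (fun k => Form E M k) (a + b + 1) ∘ₗ extDer) +
    (((a : ℝ) + b + 2) / 2) •
      (formWedge.comp (formWedge.flip (t • φ))).compr₂ (lof ℝ ℕ (fun k => Form E M k) (a + 1 + b))

open DirectSum in
/-- The deformed standard bracket on `𝔥`, the bilinear extension of `formBracketHom`. -/
noncomputable def formBracket (φ : Form E M 1) (t : ℝ) :
    AllForms E M →ₗ[ℝ] AllForms E M →ₗ[ℝ] AllForms E M :=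
  toModule ℝ ℕ _ fun a => (toModule ℝ ℕ _ fun b => (formBracketHom φ t a b).flip).flip

open DirectSum in
theorem formBracket_of (φ : Form E M 1) (t : ℝ) {a b : ℕ} (α : Form E M a) (β : Form E M b) :
    formBracket φ t (of (fun k => Form E M k) a α) (of (fun k => Form E M k) b β) =
      of (fun k => Form E M k) (a + b + 1) ((-1 : ℝ) ^ a • extDer (formWedge α β)) +
      of (fun k => Form E M k) (a + 1 + b)
        ((((a : ℝ) + b + 2) / 2) • formWedge (formWedge α (t • φ)) β) := by
  simp only [← lof_eq_of ℝ, formBracket, toModule_lof, LinearMap.flip_apply, formBracketHom,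
    LinearMap.add_apply, LinearMap.smul_apply, LinearMap.compr₂_apply, LinearMap.comp_apply,
    map_smul]

open DirectSum in
/-- The Lie derivative on `𝔥`, degree by degree. -/
noncomputable def lieAction : VectorFields E M →ₗ[ℝ] AllForms E M →ₗ[ℝ] AllForms E M :=
  (toModule ℝ ℕ _ fun k => ((lieDer k).compr₂ (lof ℝ ℕ (fun k => Form E M k) k)).flip).flip

open DirectSum in
theorem lieAction_of (X : VectorFields E M) (α : Form E M k) :
    lieAction X (of (fun k => Form E M k) k α) = of (fun k => Form E M k) k (lieDer k X α) := by
  simp only [← lof_eq_of ℝ, lieAction, toModule_lof, LinearMap.flip_apply, LinearMap.compr₂_apply]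

/-- The bracket on `𝔥 ⊕ 𝔤` given by the deformed bracket on `𝔥`, by the Jacobi–Lie bracket on `𝔤`,
and by `[X, β] = -[β, X] = L_X β` for `X` in `𝔤` and `β` in `𝔥`. -/
noncomputable def extBracket (φ : Form E M 1) (t : ℝ) (𝔤 : LieSubalgebra ℝ (VectorFields E M)) :
    (AllForms E M × 𝔤) →ₗ[ℝ] (AllForms E M × 𝔤) →ₗ[ℝ] (AllForms E M × 𝔤) :=
  LinearMap.mk₂ ℝ
    (fun u v => (formBracket φ t u.1 v.1 + lieAction (u.2 : VectorFields E M) v.1 -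
      lieAction (v.2 : VectorFields E M) u.1, ⁅u.2, v.2⁆))
    (fun _ _ _ => Prod.ext (by simp; abel) (by simp))
    (fun _ _ _ => Prod.ext (by simp [smul_add, smul_sub]) (by simp))
    (fun _ _ _ => Prod.ext (by simp; abel) (by simp))
    (fun _ _ _ => Prod.ext (by simp [smul_add, smul_sub]) (by simp))

variable (E M) in
/-- The grading of `𝔥`: `k`-forms have degree `-k - 1`. -/
noncomputable def formGrading (i : ℤ) : Submodule ℝ (AllForms E M) where
  carrier := {α | ∀ k : ℕ, -(k : ℤ) - 1 ≠ i → α k = 0}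
  add_mem' := fun h h' k hk => by rw [DirectSum.add_apply, h k hk, h' k hk, add_zero]
  zero_mem' := fun _ _ => rfl
  smul_mem' := fun c _ h k hk => by rw [DirectSum.smul_apply, h k hk, smul_zero]

/-- Vector fields have degree `0`. -/
noncomputable def vectorGrading (𝔤 : LieSubalgebra ℝ (VectorFields E M)) (i : ℤ) : Submodule ℝ 𝔤 where
  carrier := {X | i ≠ 0 → X = 0}
  add_mem' := fun h h' hi => by rw [h hi, h' hi, add_zero]
  zero_mem' := fun _ => rfl
  smul_mem' := fun c _ h hi => by rw [h hi, smul_zero]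

/-- The grading of `𝔥 ⊕ 𝔤`. -/
noncomputable def extGrading (𝔤 : LieSubalgebra ℝ (VectorFields E M)) (i : ℤ) :
    Submodule ℝ (AllForms E M × 𝔤) :=
  (formGrading E M i).prod (vectorGrading 𝔤 i)

/-- The Jacobi–Lie bracket on `𝔤`, as a bilinear map. -/
noncomputable def vectorBracket (𝔤 : LieSubalgebra ℝ (VectorFields E M)) : 𝔤 →ₗ[ℝ] 𝔤 →ₗ[ℝ] 𝔤 :=
  LinearMap.mk₂ ℝ (fun X Y => ⁅X, Y⁆) add_lie smul_lie lie_add lie_smul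

end Manifold

section Superalgebra

/-- `L` with the grading `gr` and the bracket `br` is a (`ℤ`-graded) Lie superalgebra. -/
structure IsLieSuperalgebra {L : Type*} [AddCommGroup L] [Module ℝ L] (gr : ℤ → Submodule ℝ L)
    (br : L →ₗ[ℝ] L →ₗ[ℝ] L) : Prop where
  isInternal : DirectSum.IsInternal gr
  bracket_mem : ∀ (i j : ℤ) (x y : L), x ∈ gr i → y ∈ gr j → br x y ∈ gr (i + j)
  super_symmetry : ∀ (i j : ℤ) (x y : L), x ∈ gr i → y ∈ gr j →
    br x y + (i * j).negOnePow • br y x = 0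
  super_jacobi : ∀ (i j k : ℤ) (x y z : L), x ∈ gr i → y ∈ gr j → z ∈ gr k →
    (i * k).negOnePow • br (br x y) z + (j * i).negOnePow • br (br y z) x +
      (k * j).negOnePow • br (br z x) y = 0

/-- `0 → N → L → K → 0` is an extension of Lie superalgebras: a short exact sequence of Lie
superalgebras and degree-preserving homomorphisms. -/
structure IsLieSuperalgebraExtension {N L K : Type*} [AddCommGroup N] [Module ℝ N]
    [AddCommGroup L] [Module ℝ L] [AddCommGroup K] [Module ℝ K]
    (grN : ℤ → Submodule ℝ N) (brN : N →ₗ[ℝ] N →ₗ[ℝ] N)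
    (grL : ℤ → Submodule ℝ L) (brL : L →ₗ[ℝ] L →ₗ[ℝ] L)
    (grK : ℤ → Submodule ℝ K) (brK : K →ₗ[ℝ] K →ₗ[ℝ] K)
    (f : N →ₗ[ℝ] L) (p : L →ₗ[ℝ] K) : Prop where
  kernel : IsLieSuperalgebra grN brN
  total : IsLieSuperalgebra grL brL
  quotient : IsLieSuperalgebra grK brK
  map_bracket_left : ∀ x y, f (brN x y) = brL (f x) (f y)
  map_bracket_right : ∀ x y, p (brL x y) = brK (p x) (p y)
  map_mem_left : ∀ i, ∀ x ∈ grN i, f x ∈ grL i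
  map_mem_right : ∀ i, ∀ x ∈ grL i, p x ∈ grK i
  injective : Function.Injective f
  exact_mid : Function.Exact f p
  surjective : Function.Surjective p

end Superalgebra

end DeformedForms

open DeformedForms

/-!
The proof rests on the identities of the Cartan calculus for smooth forms: the wedge product is
associative and graded commutative, `d` is an antiderivation of square zero, `L_X` is a derivation
commuting with `d`, and `[L_X, ι_Y] = ι_[X, Y]`.

To prove them without casts between degrees, a form at a point is regarded as a function on lists of
vectors (`evalList`). On such functions the wedge product (`shuffle`) and the alternatization behind
the exterior derivative (`alternatize`) are defined by recursion on the list, the recursion saying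
how contraction with a vector acts on them, and their identities follow by induction on the list.
That `shuffle` is the wedge product (`evalList_wedge`) holds because the sum over all permutations
satisfies the same recursion. An inhomogeneous form on the manifold is determined by its expressions
in charts, and there `d` is the alternatization of the derivative, while `L_X` is the directional
derivative along `X` plus the derivation of forms that extends the derivative of `X`
(`evalList_inChart_lieDer`); the identities on the manifold are read off from this.

Put `ψ = tφ` and `D_r = d + r ψ ∧ ·`, so that `D_r² = 0` because `ψ` is closed of degree one. For
homogeneous `x` and `y` of degrees `a` and `b`, the bracket is `(-1)^a D_r (x ∧ y)` with
`r = (a + b + 2) / 2`. Hence the outer bracket of all three terms of the Jacobi identity is one and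
the same `D_r`, with `r = (a + b + c + 3) / 2`. It is applied to a cyclic sum that, by the Leibniz
rule, equals `±2 D_r (x ∧ y ∧ z)`, so the total is zero (`formBracket_jacobi`). If `L_X φ = 0`, then
`L_X` commutes with `D_r`, hence acts by derivations of the bracket; together with
`L_[X, Y] = [L_X, L_Y]` this yields the mixed Jacobi identities of the extension.
-/

namespace DeformedForms

/-! ### Graded algebra of functions on lists of vectors -/

section ListFunctions

variable {V : Type*}

/-- Contraction with `v` of a form given by its values on lists: `v` is put into the first slot. -/
def contract (v : V) (f : List V → ℝ) : List V → ℝ := fun l => f (v :: l)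

/-- The grading involution: a form of degree `k` is multiplied by `(-1)^k`. -/
def signed (f : List V → ℝ) : List V → ℝ := fun l => (-1) ^ l.length * f l

/-- The wedge product of forms given by their values on lists. It is the product determined by
its value on the empty list and by the fact that contraction is an antiderivation. -/
def shuffle (f g : List V → ℝ) : List V → ℝ
  | [] => f [] * g []
  | v :: l => shuffle (contract v f) g l + shuffle (signed f) (contract v g) l
  termination_by structural l => l

/-- For `F` linear in its first argument and alternating in the others, the alternating form
`∑ (-1)^i F(v_i)(v_0, …, v_{i-1}, v_{i+1}, …)`, by recursion on the list. With `F u` the derivative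
of a form in the direction `u`, this is the exterior derivative. -/
def alternatize (F : V → List V → ℝ) : List V → ℝ
  | [] => 0
  | v :: l => F v l - alternatize (fun u => contract v (F u)) l
  termination_by structural l => l

@[simp] theorem contract_add (v : V) (f g : List V → ℝ) :
    contract v (f + g) = contract v f + contract v g := rfl

@[simp] theorem contract_neg (v : V) (f : List V → ℝ) : contract v (-f) = -contract v f := rfl

@[simp] theorem contract_smul (v : V) (c : ℝ) (f : List V → ℝ) :
    contract v (c • f) = c • contract v f := rfl

@[simp] theorem signed_add (f g : List V → ℝ) : signed (f + g) = signed f + signed g :=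
  funext fun _ => mul_add _ _ _

@[simp] theorem signed_smul (c : ℝ) (f : List V → ℝ) : signed (c • f) = c • signed f :=
  funext fun _ => mul_left_comm _ _ _

@[simp] theorem signed_signed (f : List V → ℝ) : signed (signed f) = f := by
  funext l
  simp only [signed]
  rw [← mul_assoc, ← mul_pow]
  simp

theorem contract_signed (v : V) (f : List V → ℝ) :
    contract v (signed f) = -signed (contract v f) := by
  funext l
  simp [signed, contract, pow_succ]

theorem contract_shuffle (v : V) (f g : List V → ℝ) :
    contract v (shuffle f g) = shuffle (contract v f) g + shuffle (signed f) (contract v g) := rfl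

theorem contract_alternatize (v : V) (F : V → List V → ℝ) :
    contract v (alternatize F) = F v - alternatize (fun u => contract v (F u)) := rfl

theorem shuffle_add_left (f f' g : List V → ℝ) :
    shuffle (f + f') g = shuffle f g + shuffle f' g := by
  funext l
  induction l generalizing f f' g with
  | nil => simp [shuffle, add_mul]
  | cons v l ih => simp only [shuffle, contract_add, signed_add, ih, Pi.add_apply]; ring

theorem shuffle_add_right (f g g' : List V → ℝ) :
    shuffle f (g + g') = shuffle f g + shuffle f g' := by
  funext l
  induction l generalizing f g g' with
  | nil => simp [shuffle, mul_add]
  | cons v l ih => simp only [shuffle, contract_add, ih, Pi.add_apply]; ring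

theorem shuffle_smul_left (c : ℝ) (f g : List V → ℝ) :
    shuffle (c • f) g = c • shuffle f g := by
  funext l
  induction l generalizing f g with
  | nil => simp [shuffle, mul_assoc]
  | cons v l ih =>
    simp only [shuffle, contract_smul, signed_smul, ih, Pi.smul_apply, smul_eq_mul]; ring

theorem shuffle_smul_right (c : ℝ) (f g : List V → ℝ) :
    shuffle f (c • g) = c • shuffle f g := by
  funext l
  induction l generalizing f g with
  | nil => simp [shuffle, mul_left_comm]
  | cons v l ih => simp only [shuffle, contract_smul, ih, Pi.smul_apply, smul_eq_mul]; ring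

theorem shuffle_neg_left (f g : List V → ℝ) : shuffle (-f) g = -shuffle f g := by
  simpa using shuffle_smul_left (-1) f g

theorem shuffle_neg_right (f g : List V → ℝ) : shuffle f (-g) = -shuffle f g := by
  simpa using shuffle_smul_right (-1) f g

theorem shuffle_zero_left (g : List V → ℝ) : shuffle 0 g = 0 := by
  simpa using shuffle_smul_left 0 0 g

theorem shuffle_zero_right (f : List V → ℝ) : shuffle f 0 = 0 := by
  simpa using shuffle_smul_right 0 f 0

theorem shuffle_sub_left (f f' g : List V → ℝ) :
    shuffle (f - f') g = shuffle f g - shuffle f' g := by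
  rw [sub_eq_add_neg, shuffle_add_left, shuffle_neg_left, sub_eq_add_neg]

theorem shuffle_sub_right (f g g' : List V → ℝ) :
    shuffle f (g - g') = shuffle f g - shuffle f g' := by
  rw [sub_eq_add_neg, shuffle_add_right, shuffle_neg_right, sub_eq_add_neg]

theorem signed_shuffle (f g : List V → ℝ) :
    signed (shuffle f g) = shuffle (signed f) (signed g) := by
  funext l
  induction l generalizing f g with
  | nil => simp [signed, shuffle]
  | cons v l ih =>
    have h := ih (contract v f) g
    have h' := ih (signed f) (contract v g)
    simp only [signed, shuffle, List.length_cons, pow_succ] at *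
    change _ = shuffle (contract v (signed f)) (signed g) l +
      shuffle (signed (signed f)) (contract v (signed g)) l
    rw [contract_signed, contract_signed, shuffle_neg_left, shuffle_neg_right]
    change _ = shuffle (signed (contract v f)) (signed g) l at h
    change _ = shuffle (signed (signed f)) (signed (contract v g)) l at h'
    simp only [Pi.neg_apply, ← h, ← h']
    ring

theorem shuffle_assoc (f g h : List V → ℝ) :
    shuffle (shuffle f g) h = shuffle f (shuffle g h) := by
  funext l
  induction l generalizing f g h with
  | nil => simp [shuffle, mul_assoc]
  | cons v l ih =>
    rw [shuffle, shuffle, contract_shuffle, contract_shuffle, shuffle_add_left, shuffle_add_right,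
      signed_shuffle]
    simp only [Pi.add_apply, ih]
    ring

/-- Contraction changes the parity of a form. The exponent is `a + 1` rather than `a - 1`, so that
no case distinction is needed for `a = 0`. -/
theorem signed_contract_of_signed {f : List V → ℝ} {a : ℕ} (hf : signed f = (-1 : ℝ) ^ a • f)
    (v : V) : signed (contract v f) = (-1 : ℝ) ^ (a + 1) • contract v f := by
  have h : contract v (signed f) = (-1 : ℝ) ^ a • contract v f := by rw [hf, contract_smul]
  rw [contract_signed, neg_eq_iff_eq_neg] at h
  rw [h, pow_succ]
  simp

theorem shuffle_comm_of_signed {f g : List V → ℝ} {a b : ℕ} (hf : signed f = (-1 : ℝ) ^ a • f)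
    (hg : signed g = (-1 : ℝ) ^ b • g) : shuffle f g = (-1 : ℝ) ^ (a * b) • shuffle g f := by
  funext l
  induction l generalizing f g a b with
  | nil => 
    simp only [shuffle, Pi.smul_apply, smul_eq_mul]
    have h1 := congrFun hf []
    have h2 := congrFun hg []
    simp only [signed, List.length_nil, pow_zero, one_mul, Pi.smul_apply, smul_eq_mul] at h1 h2
    rcases Nat.even_or_odd a with ha | ha
    · rw [Even.neg_one_pow (ha.mul_right b)]; ring
    -- On the empty list the parity hypothesis says that a form of odd degree vanishes there.
    · rw [ha.neg_one_pow] at h1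
      have : f [] = 0 := by linarith
      simp [this]
  | cons v l ih =>
    simp only [shuffle, Pi.smul_apply, smul_eq_mul, hf, hg, shuffle_smul_left,
      ih (signed_contract_of_signed hf v) hg, ih hf (signed_contract_of_signed hg v)]
    have h : ((-1 : ℝ) ^ a) * (-1 : ℝ) ^ (a * (b + 1)) = (-1) ^ (a * b) := by
      rw [mul_add, pow_add, mul_one, mul_left_comm, ← mul_pow]; simp
    rw [← mul_assoc, h, add_mul, pow_add, one_mul]
    ring

theorem alternatize_add (F G : V → List V → ℝ) :
    alternatize (fun u => F u + G u) = alternatize F + alternatize G := by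
  funext l
  induction l generalizing F G with
  | nil => simp [alternatize]
  | cons v l ih => simp only [alternatize, contract_add, ih, Pi.add_apply]; ring

theorem alternatize_zero : alternatize (fun _ : V => (0 : List V → ℝ)) = 0 := by
  simpa using alternatize_add (fun _ : V => (0 : List V → ℝ)) (fun _ => 0)

theorem alternatize_neg (F : V → List V → ℝ) :
    alternatize (fun u => -F u) = -alternatize F := by
  funext l
  induction l generalizing F with
  | nil => simp [alternatize]
  | cons v l ih => simp only [alternatize, contract_neg, ih, Pi.neg_apply]; ring

theorem signed_alternatize (F : V → List V → ℝ) :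
    signed (alternatize F) = -alternatize (fun u => signed (F u)) := by
  funext l
  induction l generalizing F with
  | nil => simp [alternatize, signed]
  | cons v l ih =>
    have h := ih (fun u => contract v (F u))
    simp only [Pi.neg_apply, alternatize, contract_signed, alternatize_neg, signed,
      List.length_cons] at *
    rw [pow_succ]
    linear_combination h

/-- Together with `alternatize_shuffle_right`, this is the algebraic content of the Leibniz rule for
the exterior derivative. -/
theorem alternatize_shuffle_left (F : V → List V → ℝ) (g : List V → ℝ) :
    alternatize (fun u => shuffle (F u) g) = shuffle (alternatize F) g := by
  funext l
  induction l generalizing F g with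
  | nil => simp [alternatize, shuffle]
  | cons v l ih =>
    simp only [alternatize, contract_shuffle, alternatize_add, Pi.add_apply, ih, shuffle,
      contract_alternatize, signed_alternatize, shuffle_neg_left, shuffle_sub_left, Pi.neg_apply,
      Pi.sub_apply]
    ring

theorem alternatize_shuffle_right (f : List V → ℝ) (G : V → List V → ℝ) :
    alternatize (fun u => shuffle f (G u)) = shuffle (signed f) (alternatize G) := by
  funext l
  induction l generalizing f G with
  | nil => simp [alternatize, shuffle]
  | cons v l ih =>
    simp only [alternatize, contract_shuffle, alternatize_add, Pi.add_apply, ih, shuffle,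
      contract_alternatize, contract_signed, signed_signed, shuffle_neg_left, shuffle_sub_right,
      Pi.neg_apply, Pi.sub_apply]
    ring

/-- The extension to forms of an endomorphism `T` of the vector space is a derivation of the wedge
product. -/
theorem alternatize_contract_shuffle (T : V → V) (f g : List V → ℝ) :
    alternatize (fun u => contract (T u) (shuffle f g)) =
      shuffle (alternatize fun u => contract (T u) f) g +
        shuffle f (alternatize fun u => contract (T u) g) := by
  simp only [contract_shuffle, alternatize_add, alternatize_shuffle_left,
    alternatize_shuffle_right, signed_signed]

end ListFunctions

/-! ### The wedge product as an alternating sum over all permutations -/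

section PermutationSums

/-- Expansion of an alternating sum over permutations along the position of the first vector. -/
theorem sum_perm_cons {V : Type*} {n : ℕ} (m : (Fin (n + 1) → V) → ℝ) (v : V) (w : Fin n → V) :
    ∑ σ : Equiv.Perm (Fin (n + 1)),
        ((Equiv.Perm.sign σ : ℤ) : ℝ) * m ((Fin.cons v w : Fin (n + 1) → V) ∘ σ) =
      ∑ p : Fin (n + 1), (-1 : ℝ) ^ (p : ℕ) * ∑ e : Equiv.Perm (Fin n),
        ((Equiv.Perm.sign e : ℤ) : ℝ) * m (p.insertNth v (w ∘ e)) := by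
  simp only [Finset.mul_sum]
  rw [← Fintype.sum_prod_type' (f := fun (p : Fin (n + 1)) (e : Equiv.Perm (Fin n)) =>
    (-1 : ℝ) ^ (p : ℕ) * (((Equiv.Perm.sign e : ℤ) : ℝ) * m (p.insertNth v (w ∘ e))))]
  symm
  -- A permutation is recovered from the position `p` of `0` and from the rest `e`.
  let Φ : Fin (n + 1) × Equiv.Perm (Fin n) → Equiv.Perm (Fin (n + 1)) := fun x =>
    Equiv.Perm.decomposeFin.symm (0, x.2) * Fin.cycleRange x.1
  have hΦ : Function.Bijective Φ := by
    rw [Fintype.bijective_iff_injective_and_card]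
    refine ⟨?_, ?_⟩
    · rintro ⟨p, e⟩ ⟨q, f⟩ h
      have hp : Φ (p, e) p = 0 := by simp [Φ]
      have hq : Φ (q, f) q = 0 := by simp [Φ]
      have hpq : p = q := (Φ (q, f)).injective (by rw [hq, ← h, hp])
      subst hpq
      have := Equiv.Perm.decomposeFin.symm.injective (mul_right_cancel h)
      simpa using this
    · simp [Fintype.card_perm, Nat.factorial_succ]
  refine Fintype.sum_bijective Φ hΦ _ _ fun x => ?_
  obtain ⟨p, e⟩ := x
  have h1 : (Fin.cons v w : Fin (n + 1) → V) ∘ Equiv.Perm.decomposeFin.symm (0, e) =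
      Fin.cons v (w ∘ e) := by
    funext i
    refine Fin.cases ?_ (fun j => ?_) i <;> simp
  have h2 : (Fin.cons v w : Fin (n + 1) → V) ∘ Φ (p, e) = p.insertNth v (w ∘ e) := by
    rw [Equiv.Perm.coe_mul, ← Function.comp_assoc, h1, Fin.cons_comp_cycleRange]
  rw [h2]
  simp [Φ, Equiv.Perm.sign_mul, mul_comm, mul_assoc]

theorem get_cons_eq {V : Type*} (v : V) (l : List V) :
    (v :: l).get = (Fin.cons v l.get : Fin (l.length + 1) → V) := by
  funext i
  exact Fin.cases rfl (fun _ => rfl) i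

theorem insertNth_apply_eq_ite {V : Type*} {n : ℕ} (p : Fin (n + 1)) (v : V) (x : Fin n → V)
    (q : Fin (n + 1)) : (p.insertNth v x : Fin (n + 1) → V) q =
      if h : q < p then x ⟨q, by omega⟩ else if h' : q = p then v else x ⟨q - 1, by omega⟩ := by
  rcases Fin.eq_self_or_eq_succAbove p q with rfl | ⟨k, rfl⟩
  · simp
  · rw [Fin.insertNth_apply_succAbove]
    split_ifs with h1 h2
    · refine congrArg x (Fin.ext ?_)
      rw [Fin.succAbove_lt_iff_castSucc_lt] at h1
      simp [Fin.succAbove_of_castSucc_lt _ _ h1]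
    · exact absurd h2 (Fin.succAbove_ne p k)
    · refine congrArg x (Fin.ext ?_)
      rw [Fin.succAbove_lt_iff_castSucc_lt, not_lt] at h1
      simp [Fin.succAbove_of_le_castSucc _ _ h1]

theorem sum_fin_eq_sum_add_sum {N a b : ℕ} (h : N = a + b) (f : Fin N → ℝ) :
    ∑ p, f p = ∑ i : Fin a, f ⟨i, by omega⟩ + ∑ j : Fin b, f ⟨a + j, by omega⟩ := by
  subst h
  exact Fin.sum_univ_add f

variable {E : Type*} [NormedAddCommGroup E] [NormedSpace ℝ E]

/-- The sum of `sign σ · α(u ∘ σ on the first a places) · β(u ∘ σ on the last b places)` over all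
permutations `σ`. It is `a! b!` times the wedge product; the number `n` of vectors is kept separate
from `a + b` so that no tuple has to be cast when a vector is split off. -/
noncomputable def permSum {a b n : ℕ} (h : n = a + b) (α : E [⋀^Fin a]→L[ℝ] ℝ)
    (β : E [⋀^Fin b]→L[ℝ] ℝ) (u : Fin n → E) : ℝ :=
  ∑ σ : Equiv.Perm (Fin n), ((Equiv.Perm.sign σ : ℤ) : ℝ) *
    (α (fun i => u (σ ⟨i, by omega⟩)) * β (fun j => u (σ ⟨a + j, by omega⟩)))

theorem permSum_eq_permSum_cast {a b n : ℕ} (h : n = a + b) (α : E [⋀^Fin a]→L[ℝ] ℝ)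
    (β : E [⋀^Fin b]→L[ℝ] ℝ) (u : Fin n → E) :
    permSum h α β u = permSum rfl α β (fun i => u (i.cast h.symm)) := by
  subst h
  rfl

theorem permSum_eq_wedge {a b : ℕ} (α : E [⋀^Fin a]→L[ℝ] ℝ) (β : E [⋀^Fin b]→L[ℝ] ℝ)
    (u : Fin (a + b) → E) :
    permSum rfl α β u = (a.factorial * b.factorial : ℕ) * wedge α β u := by
  have h := congrArg (fun f => LinearMap.mul' ℝ ℝ (f (u ∘ finSumFinEquiv)))
    (MultilinearMap.domCoprod_alternization_eq α.toAlternatingMap β.toAlternatingMap)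
  simp only [AlternatingMap.smul_apply, MultilinearMap.alternatization_apply, map_sum,
    Fintype.card_fin, map_nsmul, map_zsmul, Units.smul_def,
    MultilinearMap.domDomCongr_apply, MultilinearMap.domCoprod_apply, LinearMap.mul'_apply] at h
  rw [nsmul_eq_mul] at h
  refine Eq.trans ?_ h
  rw [permSum]
  refine (Fintype.sum_equiv finSumFinEquiv.permCongr _ _ fun σ => ?_).symm
  rw [Equiv.Perm.sign_permCongr, zsmul_eq_mul]
  have h1 : ∀ i : Fin a, finSumFinEquiv.symm (⟨i, by omega⟩ : Fin (a + b)) = Sum.inl i :=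
    fun i => (Equiv.symm_apply_eq _).2 rfl
  have h2 : ∀ i : Fin b, finSumFinEquiv.symm (⟨a + i, by omega⟩ : Fin (a + b)) = Sum.inr i :=
    fun i => (Equiv.symm_apply_eq _).2 rfl
  simp only [Function.comp_def, Equiv.permCongr_apply, h1, h2]
  rfl

theorem map_insertNth_mul_left {a b n : ℕ} (h : n + 1 = a + 1 + b) (α : E [⋀^Fin (a + 1)]→L[ℝ] ℝ)
    (β : E [⋀^Fin b]→L[ℝ] ℝ) (v : E) (x : Fin n → E) (i : Fin (a + 1)) :
    α (fun k => (Fin.insertNth ⟨i, by omega⟩ v x : Fin (n + 1) → E) ⟨k, by omega⟩) *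
        β (fun k => (Fin.insertNth ⟨i, by omega⟩ v x : Fin (n + 1) → E) ⟨a + 1 + k, by omega⟩) =
      (-1) ^ (i : ℕ) * (α.curryLeft v (fun k => x ⟨k, by omega⟩) *
        β (fun k => x ⟨a + k, by omega⟩)) := by
  have h1 : (fun k : Fin (a + 1) =>
      (Fin.insertNth ⟨i, by omega⟩ v x : Fin (n + 1) → E) ⟨k, by omega⟩) =
      Fin.insertNth i v (fun k => x ⟨k, by omega⟩) := by
    funext k
    simp only [insertNth_apply_eq_ite, Fin.lt_def, Fin.ext_iff]
  have h2 : (fun k : Fin b =>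
      (Fin.insertNth ⟨i, by omega⟩ v x : Fin (n + 1) → E) ⟨a + 1 + k, by omega⟩) =
      fun k : Fin b => x ⟨a + k, by omega⟩ := by
    funext k
    simp only [insertNth_apply_eq_ite, Fin.lt_def, Fin.ext_iff]
    rw [dif_neg (by omega), dif_neg (by omega)]
    exact congrArg x (Fin.ext (by simp only []; omega))
  rw [h1, h2, ContinuousAlternatingMap.map_insertNth, zsmul_eq_mul, mul_assoc]
  push_cast
  rfl

theorem map_insertNth_mul_right {a b n : ℕ} (h : n + 1 = a + (b + 1)) (α : E [⋀^Fin a]→L[ℝ] ℝ)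
    (β : E [⋀^Fin (b + 1)]→L[ℝ] ℝ) (v : E) (x : Fin n → E) (j : Fin (b + 1)) :
    α (fun k => (Fin.insertNth ⟨a + j, by omega⟩ v x : Fin (n + 1) → E) ⟨k, by omega⟩) *
        β (fun k => (Fin.insertNth ⟨a + j, by omega⟩ v x : Fin (n + 1) → E) ⟨a + k, by omega⟩) =
      (-1) ^ (j : ℕ) * (α (fun k => x ⟨k, by omega⟩) *
        β.curryLeft v (fun k => x ⟨a + k, by omega⟩)) := by
  have h1 : (fun k : Fin (b + 1) =>
      (Fin.insertNth ⟨a + j, by omega⟩ v x : Fin (n + 1) → E) ⟨a + k, by omega⟩) =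
      Fin.insertNth j v (fun k => x ⟨a + k, by omega⟩) := by
    funext k
    simp only [insertNth_apply_eq_ite, Fin.lt_def, Fin.ext_iff]
    split_ifs
    all_goals first | rfl | omega | exact congrArg x (Fin.ext (by simp only []; omega))
  have h2 : (fun k : Fin a =>
      (Fin.insertNth ⟨a + j, by omega⟩ v x : Fin (n + 1) → E) ⟨k, by omega⟩) =
      fun k : Fin a => x ⟨k, by omega⟩ := by
    funext k
    simp only [insertNth_apply_eq_ite, Fin.lt_def, Fin.ext_iff]
    rw [dif_pos (by omega)]
  rw [h1, h2, ContinuousAlternatingMap.map_insertNth, zsmul_eq_mul, mul_left_comm]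
  push_cast
  rfl

end PermutationSums

/-! ### Values of forms on lists -/

section Evaluation

variable {E : Type*} [NormedAddCommGroup E] [NormedSpace ℝ E] {a b k : ℕ}

/-- An alternating `k`-form as a function on lists of vectors, zero on lists of length other than
`k`. Forms of propositionally equal degrees can be compared through it without casts. -/
noncomputable def evalList (α : E [⋀^Fin k]→L[ℝ] ℝ) : List E → ℝ := fun l =>
  if h : l.length = k then α (fun i => l.get (i.cast h.symm)) else 0

theorem contract_evalList_zero (α : E [⋀^Fin 0]→L[ℝ] ℝ) (v : E) :
    contract v (evalList α) = 0 := by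
  funext l
  simp [contract, evalList]

theorem contract_evalList_succ (α : E [⋀^Fin (k + 1)]→L[ℝ] ℝ) (v : E) :
    contract v (evalList α) = evalList (α.curryLeft v) := by
  funext l
  simp only [contract, evalList, List.length_cons, Nat.add_right_cancel_iff]
  split_ifs with h
  · refine congrArg α (funext fun i => ?_)
    exact Fin.cases rfl (fun _ => rfl) i
  · rfl

theorem signed_evalList (α : E [⋀^Fin k]→L[ℝ] ℝ) :
    signed (evalList α) = (-1 : ℝ) ^ k • evalList α := by
  funext l
  simp only [signed, evalList, Pi.smul_apply, smul_eq_mul]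
  split_ifs with h
  · simp only [h]
  · simp

/-- Both sides satisfy the same recursion in the list: contraction is an antiderivation for
`shuffle` by definition, and for sums over permutations by `sum_perm_cons`. -/
theorem factorial_mul_shuffle_evalList (α : E [⋀^Fin a]→L[ℝ] ℝ) (β : E [⋀^Fin b]→L[ℝ] ℝ)
    (l : List E) : (a.factorial * b.factorial : ℕ) * shuffle (evalList α) (evalList β) l =
      if h : l.length = a + b then permSum h α β l.get else 0 := by
  induction l generalizing a b with
  | nil =>
    rcases a with _ | a
    · rcases b with _ | b
      · simp [shuffle, evalList, permSum]
      · simp [shuffle, evalList]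
    · rw [dif_neg (by simp only [List.length_nil]; omega)]
      simp [shuffle, evalList]
  | cons v l ih =>
    -- The terms where `v` is inserted among the arguments of `α`.
    have hl : (a.factorial * b.factorial : ℕ) *
        shuffle (contract v (evalList α)) (evalList β) l =
        if h : l.length + 1 = a + b then ∑ i : Fin a, (-1 : ℝ) ^ (i : ℕ) *
          ∑ e : Equiv.Perm (Fin l.length), ((Equiv.Perm.sign e : ℤ) : ℝ) *
            (α (fun k => (Fin.insertNth ⟨i, by omega⟩ v (l.get ∘ e) : Fin (l.length + 1) → E)
              ⟨k, by omega⟩) *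
            β (fun k => (Fin.insertNth ⟨i, by omega⟩ v (l.get ∘ e) : Fin (l.length + 1) → E)
              ⟨a + k, by omega⟩)) else 0 := by
      rcases a with _ | a
      · simp [contract_evalList_zero, shuffle_zero_left]
      · rw [contract_evalList_succ, Nat.factorial_succ, mul_assoc, Nat.cast_mul, mul_assoc, ih]
        by_cases h : l.length + 1 = a + 1 + b
        · rw [dif_pos h, dif_pos (by omega)]
          trans ∑ _i : Fin (a + 1), permSum (by omega) (α.curryLeft v) β l.get
          · simp
          refine Finset.sum_congr rfl fun i _ => ?_
          rw [permSum, Finset.mul_sum]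
          refine Finset.sum_congr rfl fun e _ => ?_
          rw [map_insertNth_mul_left h]
          have hs : (-1 : ℝ) ^ (i : ℕ) * (-1) ^ (i : ℕ) = 1 := by rw [← mul_pow]; simp
          simp only [Function.comp_apply]
          grind
        · rw [dif_neg h, dif_neg (by omega), mul_zero]
    -- The terms where `v` is inserted among the arguments of `β`.
    have hr : (a.factorial * b.factorial : ℕ) *
        ((-1) ^ a * shuffle (evalList α) (contract v (evalList β)) l) =
        if h : l.length + 1 = a + b then ∑ j : Fin b, (-1 : ℝ) ^ (a + (j : ℕ)) *
          ∑ e : Equiv.Perm (Fin l.length), ((Equiv.Perm.sign e : ℤ) : ℝ) *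
            (α (fun k => (Fin.insertNth ⟨a + j, by omega⟩ v (l.get ∘ e) : Fin (l.length + 1) → E)
              ⟨k, by omega⟩) *
            β (fun k => (Fin.insertNth ⟨a + j, by omega⟩ v (l.get ∘ e) : Fin (l.length + 1) → E)
              ⟨a + k, by omega⟩)) else 0 := by
      rcases b with _ | b
      · simp [contract_evalList_zero, shuffle_zero_right]
      · rw [contract_evalList_succ, Nat.factorial_succ, mul_left_comm a.factorial, Nat.cast_mul,
          mul_left_comm _ ((-1 : ℝ) ^ a), mul_assoc, ih]
        by_cases h : l.length + 1 = a + (b + 1)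
        · rw [dif_pos h, dif_pos (by omega)]
          trans ∑ _j : Fin (b + 1), (-1) ^ a * permSum (by omega) α (β.curryLeft v) l.get
          · simp [mul_left_comm]
          refine Finset.sum_congr rfl fun j _ => ?_
          rw [permSum, Finset.mul_sum, Finset.mul_sum]
          refine Finset.sum_congr rfl fun e _ => ?_
          rw [map_insertNth_mul_right h, pow_add]
          have hs : (-1 : ℝ) ^ (j : ℕ) * (-1) ^ (j : ℕ) = 1 := by rw [← mul_pow]; simp
          simp only [Function.comp_apply]
          grind
        · rw [dif_neg h, dif_neg (by omega), mul_zero, mul_zero]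
    rw [shuffle, signed_evalList, shuffle_smul_left, Pi.smul_apply, smul_eq_mul, mul_add, hl, hr]
    by_cases h : l.length + 1 = a + b
    · rw [dif_pos h, dif_pos h, dif_pos (by simpa using h), permSum, get_cons_eq]
      refine (sum_fin_eq_sum_add_sum h _).symm.trans (sum_perm_cons (fun u => 
        α (fun i => u ⟨i, by omega⟩) * β (fun j => u ⟨a + j, by omega⟩)) v l.get).symm
    · rw [dif_neg h, dif_neg h, dif_neg (by simpa using h), add_zero]

theorem evalList_wedge (α : E [⋀^Fin a]→L[ℝ] ℝ) (β : E [⋀^Fin b]→L[ℝ] ℝ) :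
    evalList (wedge α β) = shuffle (evalList α) (evalList β) := by
  funext l
  have h0 : ((a.factorial * b.factorial : ℕ) : ℝ) ≠ 0 := by positivity
  refine mul_left_cancel₀ h0 ?_
  rw [factorial_mul_shuffle_evalList, evalList]
  split_ifs with h
  · rw [← permSum_eq_wedge, permSum_eq_permSum_cast h]
  · rw [mul_zero]

theorem evalList_add (α β : E [⋀^Fin k]→L[ℝ] ℝ) :
    evalList (α + β) = evalList α + evalList β := by
  funext l
  simp only [evalList, Pi.add_apply]
  split_ifs <;> simp

theorem evalList_sub (α β : E [⋀^Fin k]→L[ℝ] ℝ) :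
    evalList (α - β) = evalList α - evalList β := by
  funext l
  simp only [evalList, Pi.sub_apply]
  split_ifs <;> simp

theorem evalList_zero : evalList (0 : E [⋀^Fin k]→L[ℝ] ℝ) = 0 := by
  funext l
  simp [evalList]

theorem contract_add_vector (α : E [⋀^Fin k]→L[ℝ] ℝ) (v w : E) :
    contract (v + w) (evalList α) = contract v (evalList α) + contract w (evalList α) := by
  rcases k with _ | k
  · simp [contract_evalList_zero]
  · simp [contract_evalList_succ, evalList_add]

theorem contract_sub_vector (α : E [⋀^Fin k]→L[ℝ] ℝ) (v w : E) :
    contract (v - w) (evalList α) = contract v (evalList α) - contract w (evalList α) := by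
  rcases k with _ | k
  · simp [contract_evalList_zero]
  · simp [contract_evalList_succ, evalList_sub]

theorem contract_contract_evalList_self (α : E [⋀^Fin k]→L[ℝ] ℝ) (v : E) :
    contract v (contract v (evalList α)) = 0 := by
  rcases k with _ | _ | k
  · rw [contract_evalList_zero]; rfl
  · rw [contract_evalList_succ, contract_evalList_zero]
  · rw [contract_evalList_succ, contract_evalList_succ, ContinuousAlternatingMap.curryLeft_same,
      evalList_zero]

theorem contract_contract_evalList (α : E [⋀^Fin k]→L[ℝ] ℝ) (v w : E) :
    contract v (contract w (evalList α)) = -contract w (contract v (evalList α)) := by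
  have h := contract_contract_evalList_self α (v + w)
  rcases k with _ | k
  · rw [contract_evalList_zero, contract_evalList_zero]; funext l; simp [contract]
  · have h1 := contract_contract_evalList_self α v
    have h2 := contract_contract_evalList_self α w
    rw [contract_add_vector, contract_add, contract_evalList_succ, contract_evalList_succ,
      contract_add_vector, contract_add_vector] at h
    rw [contract_evalList_succ] at h1 h2
    rw [h1, h2] at h
    rw [contract_evalList_succ, contract_evalList_succ]
    rw [eq_neg_iff_add_eq_zero]
    simpa [add_comm] using h

/-- In particular, the exterior derivative on a vector space is `alternatize` of the derivative. -/
theorem evalList_alternatizeUncurryFin (F : E →L[ℝ] E [⋀^Fin k]→L[ℝ] ℝ) :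
    evalList (ContinuousAlternatingMap.alternatizeUncurryFin F) =
      alternatize (fun u => evalList (F u)) := by
  induction k with
  | zero =>
    funext l
    rcases l with _ | ⟨v, l⟩
    · simp [evalList, alternatize]
    · simp only [alternatize, contract_evalList_zero, alternatize_zero, Pi.zero_apply, sub_zero]
      change contract v (evalList _) l = _
      rw [contract_evalList_succ]
      refine congrFun (congrArg evalList ?_) l
      ext w
      simp [ContinuousAlternatingMap.alternatizeUncurryFin_apply]
  | succ k ih =>
    funext l
    rcases l with _ | ⟨v, l⟩
    · simp [evalList, alternatize]
    · simp only [alternatize, contract_evalList_succ]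
      let G : E →L[ℝ] E [⋀^Fin k]→L[ℝ] ℝ := ((ContinuousAlternatingMap.curryLeftLI (𝕜 := ℝ)
        (E := E) (F := ℝ) (n := k)).toContinuousLinearMap.flip v).comp F
      have h : evalList (ContinuousAlternatingMap.alternatizeUncurryFin G) =
        alternatize (fun u => evalList ((F u).curryLeft v)) := ih G
      rw [← h]
      change contract v (evalList (ContinuousAlternatingMap.alternatizeUncurryFin F)) l =
        (evalList (F v) - evalList (ContinuousAlternatingMap.alternatizeUncurryFin G)) l
      rw [contract_evalList_succ, ← evalList_sub]
      refine congrFun (congrArg evalList ?_) l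
      ext w
      rw [ContinuousAlternatingMap.curryLeft_apply_apply, ContinuousAlternatingMap.sub_apply,
        ContinuousAlternatingMap.alternatizeUncurryFin_apply,
        ContinuousAlternatingMap.alternatizeUncurryFin_apply, Fin.sum_univ_succ,
        sub_eq_add_neg, ← Finset.sum_neg_distrib]
      congr 1
      · simp
      · refine Finset.sum_congr rfl fun i _ => ?_
        have hr : i.succ.removeNth (Matrix.vecCons v w) = Matrix.vecCons v (i.removeNth w) := by
          funext j
          refine Fin.cases ?_ (fun j => ?_) j <;> simp [Fin.removeNth]
        rw [hr, Fin.val_succ, pow_succ, Matrix.cons_val_succ]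
        simp [G]

end Evaluation

/-! ### Forms and vector fields in charts -/

section Manifold

variable {E : Type*} [NormedAddCommGroup E] [NormedSpace ℝ E] {M : Type*} [TopologicalSpace M]
  [ChartedSpace E M] [IsManifold 𝓘(ℝ, E) ∞ M] {a b k : ℕ}

theorem differentiableAt_inChart_of_mem_target (α : Form E M k) (x₀ : M) {y : E}
    (hy : y ∈ (chartAt E x₀).target) : DifferentiableAt ℝ (inChart x₀ α.1) y :=
  ((mem_smoothForms.1 α.2 x₀).contDiffAt
    ((chartAt E x₀).open_target.mem_nhds hy)).differentiableAt (by simp)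

/-- The value at `y` of an inhomogeneous form in the chart around `x₀`, as a function on lists: on
a list of length `k` only the component of degree `k` matters. -/
noncomputable def localForm (x₀ : M) (y : E) : AllForms E M →ₗ[ℝ] (List E → ℝ) where
  toFun η l := inChart x₀ (η l.length).1 y l.get
  map_add' _ _ := rfl
  map_smul' _ _ := rfl

theorem localForm_of (x₀ : M) (y : E) (α : Form E M k) :
    localForm x₀ y (DirectSum.of (fun k => Form E M k) k α) = evalList (inChart x₀ α.1 y) := by
  funext l
  change inChart x₀ (DirectSum.of (fun k => Form E M k) k α l.length).1 y l.get = _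
  by_cases h : l.length = k
  · subst h
    rw [DirectSum.of_eq_same]
    rw [evalList, dif_pos rfl]
    rfl
  · rw [DirectSum.of_eq_of_ne _ _ _ h, evalList, dif_neg h]
    rfl

theorem localForm_apply_of_length_eq (x₀ : M) (y : E) (η : AllForms E M) {l : List E}
    (h : l.length = k) :
    localForm x₀ y η l = inChart x₀ (η k).1 y (fun i => l.get (i.cast h.symm)) := by
  subst h
  rfl

/-- Inhomogeneous forms are determined by their expressions in charts. -/
theorem eq_of_localForm_eq {η ζ : AllForms E M}
    (h : ∀ (x₀ : M), ∀ y ∈ (chartAt E x₀).target, localForm x₀ y η = localForm x₀ y ζ) :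
    η = ζ := by
  refine DFinsupp.ext fun k => Subtype.ext (funext fun x => ?_)
  refine ContinuousAlternatingMap.ext fun v => ?_
  have hinv : (mfderiv 𝓘(ℝ, E) 𝓘(ℝ, E) (chartAt E x).symm (chartAt E x x)).comp
      (mfderiv 𝓘(ℝ, E) 𝓘(ℝ, E) (chartAt E x) x) = ContinuousLinearMap.id ℝ _ :=
    (mdifferentiable_of_mem_atlas (I := 𝓘(ℝ, E)) (chart_mem_atlas E x)).symm_comp_deriv
      (mem_chart_source E x)
  set u : Fin k → E := fun i => mfderiv 𝓘(ℝ, E) 𝓘(ℝ, E) (chartAt E x) x (v i)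
  have h1 := congrFun (h x _ (mem_chart_target E x)) (List.ofFn u)
  rw [localForm_apply_of_length_eq x _ η (List.length_ofFn (f := u)),
    localForm_apply_of_length_eq x _ ζ (List.length_ofFn (f := u))] at h1
  have heval : ∀ (ξ : RawForm E M k),
      inChart x ξ (chartAt E x x) (fun i => (List.ofFn u).get (i.cast List.length_ofFn.symm)) =
        ξ x v := by
    intro ξ
    have hcongr : ∀ (q r : M) (v w : Fin k → E), q = r → v = w →
        (show E [⋀^Fin k]→L[ℝ] ℝ from ξ q) v = (show E [⋀^Fin k]→L[ℝ] ℝ from ξ r) w := by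
      rintro q _ v _ rfl rfl; rfl
    refine hcongr _ _ _ _ ((chartAt E x).left_inv (mem_chart_source E x)) (funext fun i => ?_)
    refine Eq.trans ?_ (DFunLike.congr_fun hinv (v i))
    change mfderiv 𝓘(ℝ, E) 𝓘(ℝ, E) (chartAt E x).symm (chartAt E x x) _ =
      mfderiv 𝓘(ℝ, E) 𝓘(ℝ, E) (chartAt E x).symm (chartAt E x x) (u i)
    refine congrArg _ ?_
    simp only [List.get_ofFn]
    rfl
  rw [heval, heval] at h1
  exact h1

theorem localForm_of_formWedge (x₀ : M) (y : E) (α : Form E M a) (β : Form E M b) :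
    localForm x₀ y (DirectSum.of (fun k => Form E M k) (a + b) (formWedge α β)) =
      shuffle (evalList (inChart x₀ α.1 y)) (evalList (inChart x₀ β.1 y)) := by
  rw [localForm_of, ← evalList_wedge]
  exact congrArg evalList (wedge_compContinuousLinearMap _ _ _)

theorem evalList_inChart_extDer (x₀ : M) {y : E} (hy : y ∈ (chartAt E x₀).target)
    (α : Form E M k) : evalList (inChart x₀ (extDer α).1 y) =
      alternatize (fun u => evalList (fderiv ℝ (inChart x₀ α.1) y u)) := by
  rw [← evalList_alternatizeUncurryFin]
  exact congrArg evalList (inChart_rawExtDeriv α.2 x₀ hy)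

/-- The expression of a vector field in the chart around `x₀`. -/
noncomputable def vectorInChart (x₀ : M) (X : VectorFields E M) : E → E :=
  VectorField.mpullback 𝓘(ℝ, E) 𝓘(ℝ, E) (chartAt E x₀).symm X

theorem isInvertible_mfderiv_chart_symm (x₀ : M) {y : E} (hy : y ∈ (chartAt E x₀).target) :
    (mfderiv 𝓘(ℝ, E) 𝓘(ℝ, E) (chartAt E x₀).symm y).IsInvertible :=
  ⟨((mdifferentiable_of_mem_atlas (chart_mem_atlas E x₀)).symm).mfderiv hy, rfl⟩

variable [FiniteDimensional ℝ E]

theorem differentiableAt_vectorInChart (x₀ : M) (X : VectorFields E M) {y : E}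
    (hy : y ∈ (chartAt E x₀).target) : DifferentiableAt ℝ (vectorInChart x₀ X) y := by
  have : CompleteSpace E := FiniteDimensional.complete ℝ E
  have h : ContMDiffAt 𝓘(ℝ, E) 𝓘(ℝ, E).tangent ∞ (fun z => (⟨z, VectorField.mpullback
      𝓘(ℝ, E) 𝓘(ℝ, E) (chartAt E x₀).symm X z⟩ : TangentBundle 𝓘(ℝ, E) E)) y :=
    ContMDiffAt.mpullback_vectorField_preimage (n := ∞) (X.contMDiff _)
      (contMDiffAt_symm_of_mem_maximalAtlas (IsManifold.chart_mem_maximalAtlas x₀) hy)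
      (isInvertible_mfderiv_chart_symm x₀ hy) (by simp)
  exact (contMDiffAt_vectorSpace_iff_contDiffAt.1 h).differentiableAt (by simp)

theorem vectorInChart_lie (x₀ : M) (X Y : VectorFields E M) {y : E}
    (hy : y ∈ (chartAt E x₀).target) : vectorInChart x₀ ⁅X, Y⁆ y =
      fderiv ℝ (vectorInChart x₀ Y) y (vectorInChart x₀ X y) -
        fderiv ℝ (vectorInChart x₀ X) y (vectorInChart x₀ Y y) := by
  have : CompleteSpace E := FiniteDimensional.complete ℝ E
  have : IsManifold 𝓘(ℝ, E) (minSmoothness ℝ 2) M := by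
    rw [minSmoothness_of_isRCLikeNormedField]; infer_instance
  have h := VectorField.mpullback_mlieBracket (I := 𝓘(ℝ, E)) (n := ∞)
      (X.mdifferentiableAt (x := (chartAt E x₀).symm y))
      (Y.mdifferentiableAt (x := (chartAt E x₀).symm y))
      (contMDiffAt_symm_of_mem_maximalAtlas (IsManifold.chart_mem_maximalAtlas x₀) hy)
      (by rw [minSmoothness_of_isRCLikeNormedField]; exact ENat.LEInfty.out)
  refine h.trans ((congrFun VectorField.mlieBracketWithin_univ y).symm.trans ?_)
  exact (congrFun VectorField.mlieBracketWithin_eq_lieBracketWithin y).trans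
    (congrFun VectorField.lieBracketWithin_univ y)

theorem inChart_interiorProd (x₀ : M) (X : VectorFields E M) (α : Form E M (k + 1)) {y : E}
    (hy : y ∈ (chartAt E x₀).target) : inChart x₀ (interiorProd X α).1 y =
      (inChart x₀ α.1 y).curryLeft (vectorInChart x₀ X y) := by
  ext v
  have hXY : mfderiv 𝓘(ℝ, E) 𝓘(ℝ, E) (chartAt E x₀).symm y (vectorInChart (E := E) x₀ X y) =
    X ((chartAt E x₀).symm y) := (isInvertible_mfderiv_chart_symm x₀ hy).self_apply_inverse _
  refine congrArg (show E [⋀^Fin (k + 1)]→L[ℝ] ℝ from α.1 ((chartAt E x₀).symm y))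
    (funext fun i => ?_)
  refine Fin.cases ?_ (fun j => ?_) i
  · exact hXY.symm
  · rfl

theorem evalList_inChart_interiorProd (x₀ : M) (X : VectorFields E M) (α : Form E M (k + 1))
    {y : E} (hy : y ∈ (chartAt E x₀).target) : evalList (inChart x₀ (interiorProd X α).1 y) =
      contract (vectorInChart x₀ X y) (evalList (inChart x₀ α.1 y)) := by
  rw [inChart_interiorProd x₀ X α hy, contract_evalList_succ]

theorem fderiv_inChart_interiorProd (x₀ : M) (X : VectorFields E M) (α : Form E M (k + 1))
    {y : E} (hy : y ∈ (chartAt E x₀).target) (u : E) :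
    fderiv ℝ (inChart x₀ (interiorProd X α).1) y u =
      (fderiv ℝ (inChart x₀ α.1) y u).curryLeft (vectorInChart x₀ X y) +
        (inChart x₀ α.1 y).curryLeft (fderiv ℝ (vectorInChart x₀ X) y u) := by
  have hloc : inChart x₀ (interiorProd X α).1 =ᶠ[𝓝 y] fun z =>
      (ContinuousAlternatingMap.curryLeftLI (𝕜 := ℝ) (E := E) (F := ℝ)
        (n := k)).toContinuousLinearMap (inChart x₀ α.1 z) (vectorInChart x₀ X z) := by
    filter_upwards [(chartAt E x₀).open_target.mem_nhds hy] with z hz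
    exact inChart_interiorProd x₀ X α hz
  have h := ContinuousLinearMap.hasFDerivAt_of_bilinear
    (ContinuousAlternatingMap.curryLeftLI (𝕜 := ℝ) (E := E) (F := ℝ)
        (n := k)).toContinuousLinearMap
    (differentiableAt_inChart_of_mem_target α x₀ hy).hasFDerivAt
    (differentiableAt_vectorInChart x₀ X hy).hasFDerivAt
  rw [(h.congr_of_eventuallyEq hloc).fderiv]
  simp [add_comm]

end Manifold

/-! ### Cartan calculus -/

section Manifold

variable {E : Type*} [NormedAddCommGroup E] [NormedSpace ℝ E] {M : Type*} [TopologicalSpace M]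
  [ChartedSpace E M] [IsManifold 𝓘(ℝ, E) ∞ M] {a b k : ℕ}

theorem form_ext {α β : Form E M k} (h : ∀ (x₀ : M), ∀ y ∈ (chartAt E x₀).target,
    evalList (inChart x₀ α.1 y) = evalList (inChart x₀ β.1 y)) : α = β := by
  refine DirectSum.of_injective (β := fun k => Form E M k) k (eq_of_localForm_eq fun x₀ y hy => ?_)
  rw [localForm_of, localForm_of, h x₀ y hy]

theorem extDer_extDer (α : Form E M k) : extDer (extDer α) = 0 := by
  refine form_ext fun x₀ y hy => congrArg evalList ?_
  have hloc : inChart x₀ (extDer α).1 =ᶠ[𝓝 y] extDeriv (inChart x₀ α.1) := by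
    filter_upwards [(chartAt E x₀).open_target.mem_nhds hy] with z hz
    exact inChart_rawExtDeriv α.2 x₀ hz
  have hs : ContDiffAt ℝ ∞ (inChart x₀ α.1) y :=
    (mem_smoothForms.1 α.2 x₀).contDiffAt ((chartAt E x₀).open_target.mem_nhds hy)
  refine (inChart_rawExtDeriv (extDer α).2 x₀ hy).trans (hloc.extDeriv_eq.trans ?_)
  exact extDeriv_extDeriv_apply hs
    (by rw [minSmoothness_of_isRCLikeNormedField]; exact ENat.LEInfty.out)

theorem evalList_fderiv_inChart_formWedge (x₀ : M) {y : E} (hy : y ∈ (chartAt E x₀).target)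
    (α : Form E M a) (β : Form E M b) (u : E) :
    evalList (fderiv ℝ (inChart x₀ (formWedge α β).1) y u) =
      shuffle (evalList (fderiv ℝ (inChart x₀ α.1) y u)) (evalList (inChart x₀ β.1 y)) +
        shuffle (evalList (inChart x₀ α.1 y)) (evalList (fderiv ℝ (inChart x₀ β.1) y u)) := by
  have hloc : inChart x₀ (formWedge α β).1 = fun z =>
      wedgeCLM a b (inChart x₀ α.1 z) (inChart x₀ β.1 z) :=
    funext fun z => wedge_compContinuousLinearMap _ _ _
  have h := ContinuousLinearMap.hasFDerivAt_of_bilinear (wedgeCLM (E := E) a b)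
    (differentiableAt_inChart_of_mem_target α x₀ hy).hasFDerivAt
    (differentiableAt_inChart_of_mem_target β x₀ hy).hasFDerivAt
  rw [hloc, h.fderiv, ← evalList_wedge, ← evalList_wedge, ← evalList_add]
  refine congrArg evalList (Eq.trans ?_ (add_comm _ _))
  rfl

variable [FiniteDimensional ℝ E]

/-- In a chart, the Lie derivative along `X` is the directional derivative along `X` plus the
derivation of forms extending the derivative of `X`. The terms of Cartan's formula that involve the
derivative of the form in other directions cancel. -/
theorem evalList_inChart_lieDer (x₀ : M) {y : E} (hy : y ∈ (chartAt E x₀).target)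
    (X : VectorFields E M) (α : Form E M k) :
    evalList (inChart x₀ (lieDer k X α).1 y) =
      evalList (fderiv ℝ (inChart x₀ α.1) y (vectorInChart x₀ X y)) +
        alternatize fun u => contract (fderiv ℝ (vectorInChart x₀ X) y u)
          (evalList (inChart x₀ α.1 y)) := by
  have h1 : evalList (inChart x₀ (interiorProd X (extDer α)).1 y) =
      evalList (fderiv ℝ (inChart x₀ α.1) y (vectorInChart x₀ X y)) -
        alternatize fun u => contract (vectorInChart x₀ X y)
          (evalList (fderiv ℝ (inChart x₀ α.1) y u)) := by
    rw [evalList_inChart_interiorProd x₀ X _ hy, evalList_inChart_extDer x₀ hy,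
      contract_alternatize]
  rcases k with _ | k
  · refine h1.trans ?_
    simp only [contract_evalList_zero, alternatize_zero, sub_zero, add_zero]
  · have h2 : evalList (inChart x₀ (extDer (interiorProd X α)).1 y) =
        (alternatize fun u => contract (vectorInChart x₀ X y)
          (evalList (fderiv ℝ (inChart x₀ α.1) y u))) +
        alternatize fun u => contract (fderiv ℝ (vectorInChart x₀ X) y u)
          (evalList (inChart x₀ α.1 y)) := by
      rw [evalList_inChart_extDer x₀ hy, ← alternatize_add]
      simp only [fderiv_inChart_interiorProd x₀ X α hy, evalList_add, contract_evalList_succ]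
    have h3 : inChart x₀ (lieDer (k + 1) X α).1 y =
      inChart x₀ (interiorProd X (extDer α)).1 y + inChart x₀ (extDer (interiorProd X α)).1 y := rfl
    rw [h3, evalList_add, h1, h2]
    abel

/-- The Cartan identity `[L_X, ι_Y] = ι_[X, Y]`. -/
theorem lieDer_interiorProd (X Y : VectorFields E M) (α : Form E M (k + 1)) :
    lieDer k X (interiorProd Y α) =
      interiorProd Y (lieDer (k + 1) X α) + interiorProd ⁅X, Y⁆ α := by
  refine form_ext fun x₀ y hy => ?_
  have h : inChart x₀ (interiorProd Y (lieDer (k + 1) X α) + interiorProd ⁅X, Y⁆ α).1 y =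
    inChart x₀ (interiorProd Y (lieDer (k + 1) X α)).1 y +
      inChart x₀ (interiorProd ⁅X, Y⁆ α).1 y := rfl
  rw [h, evalList_add, evalList_inChart_lieDer x₀ hy, evalList_inChart_interiorProd x₀ _ _ hy,
    evalList_inChart_interiorProd x₀ _ _ hy, evalList_inChart_interiorProd x₀ _ _ hy,
    evalList_inChart_lieDer x₀ hy, vectorInChart_lie x₀ X Y hy, contract_sub_vector,
    fderiv_inChart_interiorProd x₀ Y α hy, evalList_add, contract_add, contract_alternatize]
  simp only [contract_contract_evalList _ (vectorInChart x₀ Y y), alternatize_neg,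
    ← contract_evalList_succ]
  abel

theorem lieDer_extDer (X : VectorFields E M) (α : Form E M k) :
    lieDer (k + 1) X (extDer α) = extDer (lieDer k X α) := by
  have h1 : lieDer (k + 1) X (extDer α) =
    interiorProd X (extDer (extDer α)) + extDer (interiorProd X (extDer α)) := rfl
  rw [h1, extDer_extDer, map_zero, zero_add]
  rcases k with _ | k
  · rfl
  · have h2 : lieDer (k + 1) X α = interiorProd X (extDer α) + extDer (interiorProd X α) := rfl
    rw [h2, map_add, extDer_extDer, add_zero]

/-- `L_[X, Y] = [L_X, L_Y]`. -/
theorem lieDer_lie (X Y : VectorFields E M) (α : Form E M k) :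
    lieDer k ⁅X, Y⁆ α = lieDer k X (lieDer k Y α) - lieDer k Y (lieDer k X α) := by
  have h1 : interiorProd ⁅X, Y⁆ (extDer α) = lieDer k X (interiorProd Y (extDer α)) -
      interiorProd Y (extDer (lieDer k X α)) := by
    rw [lieDer_interiorProd, lieDer_extDer, add_sub_cancel_left]
  rcases k with _ | k
  · exact h1
  · have h2 : extDer (interiorProd ⁅X, Y⁆ α) = lieDer (k + 1) X (extDer (interiorProd Y α)) -
        extDer (interiorProd Y (lieDer (k + 1) X α)) := by
      rw [lieDer_extDer, lieDer_interiorProd, map_add, add_sub_cancel_left]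
    have h3 : ∀ (Z : VectorFields E M) (β : Form E M (k + 1)), lieDer (k + 1) Z β =
      interiorProd Z (extDer β) + extDer (interiorProd Z β) := fun _ _ => rfl
    rw [h3 ⁅X, Y⁆, h1, h2, h3 Y α, map_add, h3 Y (lieDer (k + 1) X α)]
    abel

/-! ### Operations on inhomogeneous forms -/

section Total

open DirectSum

/-- The wedge product of inhomogeneous forms. -/
noncomputable def wedgeAll : AllForms E M →ₗ[ℝ] AllForms E M →ₗ[ℝ] AllForms E M :=
  toModule ℝ ℕ _ fun a => (toModule ℝ ℕ _ fun b =>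
    (formWedge.compr₂ (lof ℝ ℕ (fun k => Form E M k) (a + b))).flip).flip

theorem wedgeAll_of (α : Form E M a) (β : Form E M b) :
    wedgeAll (of (fun k => Form E M k) a α) (of (fun k => Form E M k) b β) =
      of (fun k => Form E M k) (a + b) (formWedge α β) := by
  simp only [← lof_eq_of ℝ, wedgeAll, toModule_lof, LinearMap.flip_apply, LinearMap.compr₂_apply]

/-- The exterior derivative of inhomogeneous forms. -/
noncomputable def extDerAll : AllForms E M →ₗ[ℝ] AllForms E M :=
  toModule ℝ ℕ _ fun k => lof ℝ ℕ (fun k => Form E M k) (k + 1) ∘ₗ extDer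

theorem extDerAll_of (α : Form E M k) : extDerAll (of (fun k => Form E M k) k α) =
    of (fun k => Form E M k) (k + 1) (extDer α) := by
  simp only [← lof_eq_of ℝ, extDerAll, toModule_lof, LinearMap.comp_apply]

variable (E M) in
/-- The forms of degree `k`, as a subspace of the space of all forms. -/
noncomputable def homogeneous (k : ℕ) : Submodule ℝ (AllForms E M) :=
  LinearMap.range (lof ℝ ℕ (fun k => Form E M k) k)

theorem of_mem_homogeneous (α : Form E M k) :
    of (fun k => Form E M k) k α ∈ homogeneous E M k := ⟨α, rfl⟩

theorem exists_of_mem_homogeneous {x : AllForms E M} (hx : x ∈ homogeneous E M k) :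
    ∃ α : Form E M k, x = of (fun k => Form E M k) k α := by
  obtain ⟨α, rfl⟩ := hx
  exact ⟨α, rfl⟩

theorem localForm_wedgeAll (x₀ : M) (y : E) (x z : AllForms E M) :
    localForm x₀ y (wedgeAll x z) = shuffle (localForm x₀ y x) (localForm x₀ y z) := by
  induction x using DirectSum.induction_on with
  | zero => simp [shuffle_zero_left]
  | add x x' hx hx' =>
    rw [map_add, LinearMap.add_apply, map_add, map_add, shuffle_add_left, hx, hx']
  | of a α =>
    induction z using DirectSum.induction_on with
    | zero => simp [shuffle_zero_right]
    | add z z' hz hz' => rw [map_add, map_add, map_add, shuffle_add_right, hz, hz']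
    | of b β => rw [wedgeAll_of, localForm_of_formWedge, localForm_of, localForm_of]

theorem wedgeAll_assoc (x y z : AllForms E M) :
    wedgeAll (wedgeAll x y) z = wedgeAll x (wedgeAll y z) :=
  eq_of_localForm_eq fun x₀ p _ => by simp only [localForm_wedgeAll, shuffle_assoc]

theorem signed_localForm {x : AllForms E M} (hx : x ∈ homogeneous E M a) (x₀ : M) (y : E) :
    signed (localForm x₀ y x) = (-1 : ℝ) ^ a • localForm x₀ y x := by
  obtain ⟨α, rfl⟩ := exists_of_mem_homogeneous hx
  rw [localForm_of, signed_evalList]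

theorem wedgeAll_comm {x y : AllForms E M} (hx : x ∈ homogeneous E M a)
    (hy : y ∈ homogeneous E M b) : wedgeAll x y = (-1 : ℝ) ^ (a * b) • wedgeAll y x :=
  eq_of_localForm_eq fun x₀ p _ => by
    rw [map_smul, localForm_wedgeAll, localForm_wedgeAll,
      shuffle_comm_of_signed (signed_localForm hx x₀ p) (signed_localForm hy x₀ p)]

theorem wedgeAll_mem {x y : AllForms E M} (hx : x ∈ homogeneous E M a)
    (hy : y ∈ homogeneous E M b) : wedgeAll x y ∈ homogeneous E M (a + b) := by
  obtain ⟨α, rfl⟩ := exists_of_mem_homogeneous hx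
  obtain ⟨β, rfl⟩ := exists_of_mem_homogeneous hy
  rw [wedgeAll_of]
  exact of_mem_homogeneous _

theorem extDerAll_mem {x : AllForms E M} (hx : x ∈ homogeneous E M a) :
    extDerAll x ∈ homogeneous E M (a + 1) := by
  obtain ⟨α, rfl⟩ := exists_of_mem_homogeneous hx
  rw [extDerAll_of]
  exact of_mem_homogeneous _

theorem lieAction_mem (X : VectorFields E M) {x : AllForms E M} (hx : x ∈ homogeneous E M a) :
    lieAction X x ∈ homogeneous E M a := by
  obtain ⟨α, rfl⟩ := exists_of_mem_homogeneous hx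
  rw [lieAction_of]
  exact of_mem_homogeneous _

theorem extDerAll_extDerAll (x : AllForms E M) : extDerAll (extDerAll x) = 0 := by
  induction x using DirectSum.induction_on with
  | zero => simp
  | add x x' hx hx' => rw [map_add, map_add, hx, hx', add_zero]
  | of a α => rw [extDerAll_of, extDerAll_of, extDer_extDer, map_zero]

/-- The Leibniz rule for the exterior derivative. -/
theorem extDerAll_wedgeAll {x : AllForms E M} (hx : x ∈ homogeneous E M a) (z : AllForms E M) :
    extDerAll (wedgeAll x z) =
      wedgeAll (extDerAll x) z + (-1 : ℝ) ^ a • wedgeAll x (extDerAll z) := by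
  obtain ⟨α, rfl⟩ := exists_of_mem_homogeneous hx
  induction z using DirectSum.induction_on with
  | zero => simp
  | add z z' hz hz' => simp only [map_add, hz, hz', smul_add]; abel
  | of b β =>
    refine eq_of_localForm_eq fun x₀ y hy => ?_
    rw [map_add, map_smul, localForm_wedgeAll, localForm_wedgeAll, wedgeAll_of, extDerAll_of,
      extDerAll_of, extDerAll_of]
    simp only [localForm_of]
    rw [evalList_inChart_extDer x₀ hy, evalList_inChart_extDer x₀ hy,
      evalList_inChart_extDer x₀ hy, ← shuffle_smul_left, ← signed_evalList]
    simp only [evalList_fderiv_inChart_formWedge x₀ hy, alternatize_add,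
      alternatize_shuffle_left, alternatize_shuffle_right]

theorem lieAction_wedgeAll (X : VectorFields E M) (x z : AllForms E M) :
    lieAction X (wedgeAll x z) = wedgeAll (lieAction X x) z + wedgeAll x (lieAction X z) := by
  induction x using DirectSum.induction_on with
  | zero => simp
  | add x x' hx hx' => simp only [map_add, LinearMap.add_apply, hx, hx']; abel
  | of a α =>
    induction z using DirectSum.induction_on with
    | zero => simp
    | add z z' hz hz' => simp only [map_add, hz, hz']; abel
    | of b β =>
      refine eq_of_localForm_eq fun x₀ y hy => ?_
      rw [map_add, localForm_wedgeAll, localForm_wedgeAll, wedgeAll_of, lieAction_of, lieAction_of,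
        lieAction_of]
      have hw := localForm_of_formWedge x₀ y α β
      simp only [localForm_of] at hw ⊢
      rw [evalList_inChart_lieDer x₀ hy, evalList_inChart_lieDer x₀ hy,
        evalList_inChart_lieDer x₀ hy, evalList_fderiv_inChart_formWedge x₀ hy, hw,
        alternatize_contract_shuffle, shuffle_add_left, shuffle_add_right]
      abel

theorem lieAction_extDerAll (X : VectorFields E M) (x : AllForms E M) :
    lieAction X (extDerAll x) = extDerAll (lieAction X x) := by
  induction x using DirectSum.induction_on with
  | zero => simp
  | add x x' hx hx' => simp only [map_add, hx, hx']
  | of a α => rw [extDerAll_of, lieAction_of, lieAction_of, extDerAll_of, lieDer_extDer]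

theorem lieAction_lie (X Y : VectorFields E M) (x : AllForms E M) :
    lieAction ⁅X, Y⁆ x = lieAction X (lieAction Y x) - lieAction Y (lieAction X x) := by
  induction x using DirectSum.induction_on with
  | zero => simp
  | add x x' hx hx' => simp only [map_add, hx, hx']; abel
  | of a α => simp only [lieAction_of, lieDer_lie, map_sub]

end Total

end Manifold

section Manifold

variable {E : Type*} [NormedAddCommGroup E] [NormedSpace ℝ E] {M : Type*} [TopologicalSpace M]
  [ChartedSpace E M] [IsManifold 𝓘(ℝ, E) ∞ M] {a b c k : ℕ}
variable [FiniteDimensional ℝ E]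

/-! ### The deformed bracket -/

section Bracket

open DirectSum

/-- The twisted exterior derivative `x ↦ dx + r ψ ∧ x`. -/
noncomputable def twistedDer (ψ : AllForms E M) (r : ℝ) : AllForms E M →ₗ[ℝ] AllForms E M :=
  extDerAll + r • wedgeAll ψ

theorem twistedDer_apply (ψ : AllForms E M) (r : ℝ) (x : AllForms E M) :
    twistedDer ψ r x = extDerAll x + r • wedgeAll ψ x := rfl

theorem twistedDer_mem {ψ : AllForms E M} (hψ : ψ ∈ homogeneous E M 1) (r : ℝ) {x : AllForms E M}
    (hx : x ∈ homogeneous E M a) : twistedDer ψ r x ∈ homogeneous E M (a + 1) := by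
  refine add_mem (extDerAll_mem hx) (Submodule.smul_mem _ _ ?_)
  rw [add_comm]
  exact wedgeAll_mem hψ hx

theorem wedgeAll_self_of_mem_one {ψ : AllForms E M} (hψ : ψ ∈ homogeneous E M 1) :
    wedgeAll ψ ψ = 0 := by
  have h := wedgeAll_comm hψ hψ
  simp only [mul_one, pow_one, neg_smul, one_smul] at h
  have h2 : (2 : ℝ) • wedgeAll ψ ψ = 0 := by
    rw [two_smul]
    exact eq_neg_iff_add_eq_zero.1 h
  exact (smul_eq_zero.1 h2).resolve_left two_ne_zero

/-- The twisted exterior derivative of a closed `1`-form squares to zero, for every constant `r`. -/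
theorem twistedDer_twistedDer {ψ : AllForms E M} (hψ : ψ ∈ homogeneous E M 1)
    (hd : extDerAll ψ = 0) (r : ℝ) (x : AllForms E M) :
    twistedDer ψ r (twistedDer ψ r x) = 0 := by
  simp only [twistedDer_apply, map_add, map_smul, extDerAll_extDerAll, extDerAll_wedgeAll hψ,
    hd, ← wedgeAll_assoc, wedgeAll_self_of_mem_one hψ, map_zero, LinearMap.zero_apply]
  module

theorem lieAction_twistedDer {X : VectorFields E M} {ψ : AllForms E M} (hX : lieAction X ψ = 0)
    (r : ℝ) (x : AllForms E M) :
    lieAction X (twistedDer ψ r x) = twistedDer ψ r (lieAction X x) := by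
  simp only [twistedDer_apply, map_add, map_smul, lieAction_extDerAll, lieAction_wedgeAll, hX,
    map_zero, LinearMap.zero_apply, zero_add]

theorem wedgeAll_twistedDer_wedgeAll {x ψ : AllForms E M} (hx : x ∈ homogeneous E M a) (r : ℝ)
    (y z : AllForms E M) : wedgeAll (twistedDer ψ r (wedgeAll x y)) z =
      wedgeAll (wedgeAll (extDerAll x) y) z + (-1 : ℝ) ^ a • wedgeAll (wedgeAll x (extDerAll y)) z +
        r • wedgeAll ψ (wedgeAll (wedgeAll x y) z) := by
  simp only [twistedDer_apply, extDerAll_wedgeAll hx, map_add, map_smul, LinearMap.add_apply,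
    LinearMap.smul_apply, wedgeAll_assoc]

theorem wedgeAll_rotate {x y z : AllForms E M} (hx : x ∈ homogeneous E M a)
    (hy : y ∈ homogeneous E M b) (hz : z ∈ homogeneous E M c) :
    wedgeAll (wedgeAll y z) x = (-1 : ℝ) ^ ((b + c) * a) • wedgeAll (wedgeAll x y) z := by
  rw [wedgeAll_comm (wedgeAll_mem hy hz) hx, wedgeAll_assoc]

theorem wedgeAll_rotate_symm {x y z : AllForms E M} (hx : x ∈ homogeneous E M a)
    (hy : y ∈ homogeneous E M b) (hz : z ∈ homogeneous E M c) :
    wedgeAll (wedgeAll z x) y = (-1 : ℝ) ^ (c * (a + b)) • wedgeAll (wedgeAll x y) z := by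
  rw [wedgeAll_assoc, wedgeAll_comm hz (wedgeAll_mem hx hy)]

/-- The `1`-form `tφ` as an inhomogeneous form. -/
noncomputable def twistingForm (φ : Form E M 1) (t : ℝ) : AllForms E M :=
  of (fun k => Form E M k) 1 (t • φ)

theorem twistingForm_mem (φ : Form E M 1) (t : ℝ) : twistingForm φ t ∈ homogeneous E M 1 :=
  of_mem_homogeneous _

theorem extDerAll_twistingForm {φ : Form E M 1} (hφ : extDer φ = 0) (t : ℝ) :
    extDerAll (twistingForm φ t) = 0 := by
  rw [twistingForm, extDerAll_of, map_smul, hφ, smul_zero, map_zero]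

theorem lieAction_twistingForm {φ : Form E M 1} {X : VectorFields E M} (hX : lieDer 1 X φ = 0)
    (t : ℝ) : lieAction X (twistingForm φ t) = 0 := by
  rw [twistingForm, lieAction_of, map_smul, hX, smul_zero, map_zero]

/-- Up to sign, the deformed bracket is the twisted exterior derivative of the wedge product, with a
constant that depends on the degree. -/
theorem formBracket_eq_twistedDer (φ : Form E M 1) (t : ℝ) {x y : AllForms E M}
    (hx : x ∈ homogeneous E M a) (hy : y ∈ homogeneous E M b) :
    formBracket φ t x y =
      (-1 : ℝ) ^ a • twistedDer (twistingForm φ t) (((a : ℝ) + b + 2) / 2) (wedgeAll x y) := by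
  have h : wedgeAll (wedgeAll x (twistingForm φ t)) y =
      (-1 : ℝ) ^ a • wedgeAll (twistingForm φ t) (wedgeAll x y) := by
    rw [wedgeAll_comm hx (twistingForm_mem φ t), mul_one, map_smul, LinearMap.smul_apply,
      wedgeAll_assoc]
  have h' : formBracket φ t x y = (-1 : ℝ) ^ a • extDerAll (wedgeAll x y) +
      (((a : ℝ) + b + 2) / 2) • wedgeAll (wedgeAll x (twistingForm φ t)) y := by
    obtain ⟨α, rfl⟩ := exists_of_mem_homogeneous hx
    obtain ⟨β, rfl⟩ := exists_of_mem_homogeneous hy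
    rw [formBracket_of, twistingForm, wedgeAll_of, wedgeAll_of, wedgeAll_of, extDerAll_of]
    simp only [← lof_eq_of ℝ, map_smul]
  rw [h', h, twistedDer_apply]
  module

theorem formBracket_mem (φ : Form E M 1) (t : ℝ) {x y : AllForms E M}
    (hx : x ∈ homogeneous E M a) (hy : y ∈ homogeneous E M b) :
    formBracket φ t x y ∈ homogeneous E M (a + b + 1) := by
  rw [formBracket_eq_twistedDer φ t hx hy]
  exact Submodule.smul_mem _ _ (twistedDer_mem (twistingForm_mem φ t) _ (wedgeAll_mem hx hy))

theorem formBracket_swap (φ : Form E M 1) (t : ℝ) {x y : AllForms E M}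
    (hx : x ∈ homogeneous E M a) (hy : y ∈ homogeneous E M b) :
    formBracket φ t x y + (-1 : ℝ) ^ ((a + 1) * (b + 1)) • formBracket φ t y x = 0 := by
  rw [formBracket_eq_twistedDer φ t hx hy, formBracket_eq_twistedDer φ t hy hx,
    wedgeAll_comm hx hy, add_comm (b : ℝ), map_smul]
  simp only [add_mul, mul_add, pow_add, pow_mul, one_mul, mul_one, pow_one]
  rcases neg_one_pow_eq_or ℝ a with ha | ha <;> rcases neg_one_pow_eq_or ℝ b with hb | hb <;>
    simp only [ha, hb, one_pow] <;> module

/-- All three double brackets are values of one twisted exterior derivative `d + r tφ`, with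
`r = (a + b + c + 3) / 2`. By the Leibniz rule, the cyclic sum of their arguments is a multiple of
`(d + r tφ)(x ∧ y ∧ z)`, and the twisted exterior derivative squares to zero. -/
theorem formBracket_jacobi {φ : Form E M 1} (hφ : extDer φ = 0) (t : ℝ) {x y z : AllForms E M}
    (hx : x ∈ homogeneous E M a) (hy : y ∈ homogeneous E M b) (hz : z ∈ homogeneous E M c) :
    (-1 : ℝ) ^ ((a + 1) * (c + 1)) • formBracket φ t (formBracket φ t x y) z +
      (-1 : ℝ) ^ ((b + 1) * (a + 1)) • formBracket φ t (formBracket φ t y z) x +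
      (-1 : ℝ) ^ ((c + 1) * (b + 1)) • formBracket φ t (formBracket φ t z x) y = 0 := by
  set ψ := twistingForm φ t
  have hψ : ψ ∈ homogeneous E M 1 := twistingForm_mem φ t
  set r : ℝ := ((a : ℝ) + b + c + 3) / 2 with hr
  have hbr : ∀ {a b c : ℕ} {x y z : AllForms E M}, x ∈ homogeneous E M a → y ∈ homogeneous E M b →
      z ∈ homogeneous E M c → ((a : ℝ) + b + c + 3) / 2 = r →
      formBracket φ t (formBracket φ t x y) z = twistedDer ψ r (((-1 : ℝ) ^ (b + 1)) •
        wedgeAll (twistedDer ψ (((a : ℝ) + b + 2) / 2) (wedgeAll x y)) z) := by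
    intro a b c x y z hx hy hz h
    rw [formBracket_eq_twistedDer φ t (formBracket_mem φ t hx hy) hz,
      formBracket_eq_twistedDer φ t hx hy]
    simp only [map_smul, LinearMap.smul_apply, smul_smul]
    congr 1
    · rw [← pow_add, show a + b + 1 + a = (b + 1) + 2 * a by ring, pow_add, pow_mul]
      simp
    · rw [show (((a + b + 1 : ℕ) : ℝ) + c + 2) / 2 = r by rw [← h]; push_cast; ring]
  have hD : extDerAll (wedgeAll (wedgeAll x y) z) = wedgeAll (wedgeAll (extDerAll x) y) z +
      (-1 : ℝ) ^ a • wedgeAll (wedgeAll x (extDerAll y)) z +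
        (-1 : ℝ) ^ (a + b) • wedgeAll (wedgeAll x y) (extDerAll z) := by
    rw [extDerAll_wedgeAll (wedgeAll_mem hx hy), extDerAll_wedgeAll hx]
    simp only [map_add, map_smul, LinearMap.add_apply, LinearMap.smul_apply]
  have key : ∃ s : ℝ,
      (-1 : ℝ) ^ ((a + 1) * (c + 1)) • ((-1 : ℝ) ^ (b + 1)) •
          wedgeAll (twistedDer ψ (((a : ℝ) + b + 2) / 2) (wedgeAll x y)) z +
        (-1 : ℝ) ^ ((b + 1) * (a + 1)) • ((-1 : ℝ) ^ (c + 1)) •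
          wedgeAll (twistedDer ψ (((b : ℝ) + c + 2) / 2) (wedgeAll y z)) x +
        (-1 : ℝ) ^ ((c + 1) * (b + 1)) • ((-1 : ℝ) ^ (a + 1)) •
          wedgeAll (twistedDer ψ (((c : ℝ) + a + 2) / 2) (wedgeAll z x)) y =
      s • twistedDer ψ r (wedgeAll (wedgeAll x y) z) := by
    refine ⟨2 * (-1) ^ (a * c + a + b + c), ?_⟩
    rw [wedgeAll_twistedDer_wedgeAll hx, wedgeAll_twistedDer_wedgeAll hy,
      wedgeAll_twistedDer_wedgeAll hz, twistedDer_apply, hD,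
      wedgeAll_rotate hx (extDerAll_mem hy) hz, wedgeAll_rotate hx hy (extDerAll_mem hz),
      wedgeAll_rotate hx hy hz, wedgeAll_rotate_symm hx hy (extDerAll_mem hz),
      wedgeAll_rotate_symm (extDerAll_mem hx) hy hz, wedgeAll_rotate_symm hx hy hz, hr]
    simp only [map_smul, add_mul, mul_add, pow_add, pow_mul, one_mul, mul_one, pow_one]
    -- All signs are determined by the parities of the three degrees.
    rcases neg_one_pow_eq_or ℝ a with ha | ha <;> rcases neg_one_pow_eq_or ℝ b with hb | hb <;>
      rcases neg_one_pow_eq_or ℝ c with hc | hc <;> simp only [ha, hb, hc, one_pow] <;> module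
  obtain ⟨s, hs⟩ := key
  have hT := congrArg (twistedDer ψ r) hs
  rw [map_smul, twistedDer_twistedDer hψ (extDerAll_twistingForm hφ t), smul_zero] at hT
  rw [hbr hx hy hz rfl, hbr hy hz hx (by rw [hr]; ring), hbr hz hx hy (by rw [hr]; ring)]
  simp only [map_add, map_smul] at hT ⊢
  exact hT

/-- A vector field that preserves `φ` acts on the forms by derivations of the deformed bracket. -/
theorem lieAction_formBracket {φ : Form E M 1} {X : VectorFields E M} (hX : lieDer 1 X φ = 0)
    (t : ℝ) {x y : AllForms E M} (hx : x ∈ homogeneous E M a) (hy : y ∈ homogeneous E M b) :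
    lieAction X (formBracket φ t x y) =
      formBracket φ t (lieAction X x) y + formBracket φ t x (lieAction X y) := by
  rw [formBracket_eq_twistedDer φ t hx hy, formBracket_eq_twistedDer φ t (lieAction_mem X hx) hy,
    formBracket_eq_twistedDer φ t hx (lieAction_mem X hy), map_smul,
    lieAction_twistedDer (lieAction_twistingForm hX t), lieAction_wedgeAll, map_add, smul_add]

end Bracket

end Manifold

/-! ### Gradings -/

section Grading

theorem isInternal_of_projections {L : Type*} [AddCommGroup L] [Module ℝ L]
    {gr : ℤ → Submodule ℝ L} (hπ : ∀ i, ∃ π : L →ₗ[ℝ] L, (∀ x ∈ gr i, π x = x) ∧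
      ∀ j, j ≠ i → ∀ x ∈ gr j, π x = 0) (htop : ⨆ i, gr i = ⊤) : DirectSum.IsInternal gr := by
  refine (DirectSum.isInternal_submodule_iff_iSupIndep_and_iSup_eq_top gr).2 ⟨?_, htop⟩
  intro i
  obtain ⟨π, h1, h2⟩ := hπ i
  rw [Submodule.disjoint_def]
  intro x hx hx'
  have hle : ⨆ j, ⨆ (_ : j ≠ i), gr j ≤ LinearMap.ker π :=
    iSup₂_le fun j hj y hy => h2 j hj y hy
  rw [← h1 x hx]
  exact hle hx'

variable {E : Type*} [NormedAddCommGroup E] [NormedSpace ℝ E] {M : Type*} [TopologicalSpace M]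
  [ChartedSpace E M] [IsManifold 𝓘(ℝ, E) ∞ M] [FiniteDimensional ℝ E] {a b k : ℕ}

theorem mem_homogeneous_iff {x : AllForms E M} :
    x ∈ homogeneous E M k ↔ ∀ m, m ≠ k → x m = 0 := by
  refine ⟨?_, fun h => ⟨x k, DFinsupp.ext fun m => ?_⟩⟩
  · rintro ⟨α, rfl⟩ m hm
    exact DirectSum.of_eq_of_ne _ _ _ hm
  · rcases eq_or_ne m k with rfl | hm
    · exact DirectSum.of_eq_same _ _
    · rw [h m hm]
      exact DirectSum.of_eq_of_ne _ _ _ hm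

theorem formGrading_eq_homogeneous (k : ℕ) :
    formGrading E M (-(k : ℤ) - 1) = homogeneous E M k := by
  ext x
  rw [mem_homogeneous_iff]
  refine forall_congr' fun m => ?_
  rw [show -(m : ℤ) - 1 ≠ -(k : ℤ) - 1 ↔ m ≠ k by omega]

/-- A nonzero graded element sits in degree `-k - 1` for some `k`; the other degrees are trivial. -/
theorem formGrading_cases {i : ℤ} {x : AllForms E M} (hx : x ∈ formGrading E M i) :
    x = 0 ∨ ∃ k : ℕ, i = -(k : ℤ) - 1 ∧ x ∈ homogeneous E M k := by
  by_cases h : ∃ k : ℕ, i = -(k : ℤ) - 1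
  · obtain ⟨k, rfl⟩ := h
    exact Or.inr ⟨k, rfl, formGrading_eq_homogeneous (E := E) (M := M) k ▸ hx⟩
  · exact Or.inl (DFinsupp.ext fun k => hx k fun hk => h ⟨k, hk.symm⟩)

theorem exists_projection_formGrading (i : ℤ) : ∃ π : AllForms E M →ₗ[ℝ] AllForms E M,
    (∀ x ∈ formGrading E M i, π x = x) ∧ ∀ j, j ≠ i → ∀ x ∈ formGrading E M j, π x = 0 := by
  by_cases h : ∃ k : ℕ, i = -(k : ℤ) - 1
  · obtain ⟨k, rfl⟩ := h
    refine ⟨DirectSum.lof ℝ ℕ (fun k => Form E M k) k ∘ₗ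
      DirectSum.component ℝ ℕ (fun k => Form E M k) k, fun x hx => ?_, fun j hj x hx => ?_⟩
    · rw [formGrading_eq_homogeneous] at hx
      obtain ⟨α, rfl⟩ := hx
      simp
    · have hk : DirectSum.component ℝ ℕ (fun k => Form E M k) k x = 0 := hx k hj.symm
      rw [LinearMap.comp_apply, hk, map_zero]
  · refine ⟨0, fun x hx => ?_, fun _ _ _ _ => rfl⟩
    rcases formGrading_cases hx with rfl | ⟨k, hk, -⟩
    · rfl
    · exact absurd ⟨k, hk⟩ h

theorem iSup_formGrading : ⨆ i, formGrading E M i = ⊤ := by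
  refine eq_top_iff.2 fun x _ => ?_
  induction x using DirectSum.induction_on with
  | zero => exact zero_mem _
  | add x y hx hy => exact add_mem (hx trivial) (hy trivial)
  | of k α =>
    refine Submodule.mem_iSup_of_mem (-(k : ℤ) - 1) ?_
    rw [formGrading_eq_homogeneous]
    exact of_mem_homogeneous α

variable (𝔤 : LieSubalgebra ℝ (VectorFields E M))

theorem exists_projection_vectorGrading (i : ℤ) : ∃ π : 𝔤 →ₗ[ℝ] 𝔤,
    (∀ x ∈ vectorGrading 𝔤 i, π x = x) ∧ ∀ j, j ≠ i → ∀ x ∈ vectorGrading 𝔤 j, π x = 0 := by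
  rcases eq_or_ne i 0 with rfl | hi
  · exact ⟨LinearMap.id, fun _ _ => rfl, fun j hj x hx => hx hj⟩
  · exact ⟨0, fun x hx => (hx hi).symm, fun _ _ _ _ => rfl⟩

theorem iSup_vectorGrading : ⨆ i, vectorGrading 𝔤 i = ⊤ :=
  eq_top_iff.2 fun _ _ => Submodule.mem_iSup_of_mem 0 fun h => absurd rfl h

theorem isInternal_formGrading : DirectSum.IsInternal (formGrading E M) :=
  isInternal_of_projections exists_projection_formGrading iSup_formGrading

theorem isInternal_vectorGrading : DirectSum.IsInternal (vectorGrading 𝔤) :=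
  isInternal_of_projections (exists_projection_vectorGrading 𝔤) (iSup_vectorGrading 𝔤)

theorem isInternal_extGrading : DirectSum.IsInternal (extGrading 𝔤) := by
  refine isInternal_of_projections (fun i => ?_) (eq_top_iff.2 fun x _ => ?_)
  · obtain ⟨π, h1, h2⟩ := exists_projection_formGrading (E := E) (M := M) i
    obtain ⟨ρ, h3, h4⟩ := exists_projection_vectorGrading 𝔤 i
    exact ⟨π.prodMap ρ, fun x hx => Prod.ext (h1 _ hx.1) (h3 _ hx.2),
      fun j hj x hx => Prod.ext (h2 j hj _ hx.1) (h4 j hj _ hx.2)⟩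
  · have hl : (⊤ : Submodule ℝ (AllForms E M)) ≤
        (⨆ i, extGrading 𝔤 i).comap (LinearMap.inl ℝ (AllForms E M) 𝔤) := by
      rw [← iSup_formGrading]
      exact iSup_le fun i y hy => Submodule.mem_iSup_of_mem i ⟨hy, zero_mem _⟩
    have hr : (⊤ : Submodule ℝ 𝔤) ≤
        (⨆ i, extGrading 𝔤 i).comap (LinearMap.inr ℝ (AllForms E M) 𝔤) := by
      rw [← iSup_vectorGrading]
      exact iSup_le fun i y hy => Submodule.mem_iSup_of_mem i ⟨zero_mem _, hy⟩
    have hx : x = LinearMap.inl ℝ (AllForms E M) 𝔤 x.1 + LinearMap.inr ℝ (AllForms E M) 𝔤 x.2 :=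
      Prod.ext (by simp) (by simp)
    rw [hx]
    exact add_mem (hl (Submodule.mem_top : x.1 ∈ (⊤ : Submodule ℝ (AllForms E M))))
      (hr (Submodule.mem_top : x.2 ∈ (⊤ : Submodule ℝ 𝔤)))

theorem extGrading_cases {i : ℤ} {u : AllForms E M × 𝔤} (hu : u ∈ extGrading 𝔤 i) :
    u = 0 ∨ (i = 0 ∧ ∃ X : 𝔤, u = (0, X)) ∨
      ∃ k : ℕ, i = -(k : ℤ) - 1 ∧ ∃ x ∈ homogeneous E M k, u = (x, 0) := by
  obtain ⟨x, X⟩ := u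
  obtain ⟨hx, hX⟩ := hu
  rcases formGrading_cases hx with h | ⟨k, hk, h⟩
  · have h : x = 0 := h
    subst h
    rcases eq_or_ne i 0 with hi | hi
    · exact Or.inr (Or.inl ⟨hi, X, rfl⟩)
    · exact Or.inl (Prod.ext rfl (hX hi))
  · exact Or.inr (Or.inr ⟨k, hk, x, h, Prod.ext rfl (hX (by omega))⟩)

theorem negOnePow_smul_eq {L : Type*} [AddCommGroup L] [Module ℝ L] (a b : ℕ) (x : L) :
    ((-(a : ℤ) - 1) * (-(b : ℤ) - 1)).negOnePow • x = (-1 : ℝ) ^ ((a + 1) * (b + 1)) • x := by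
  rw [show (-(a : ℤ) - 1) * (-(b : ℤ) - 1) = (((a + 1) * (b + 1) : ℕ) : ℤ) by push_cast; ring]
  rcases Nat.even_or_odd ((a + 1) * (b + 1)) with h | h
  · rw [h.neg_one_pow, Int.negOnePow_even _ (by exact_mod_cast h), one_smul, one_smul]
  · rw [h.neg_one_pow, Int.negOnePow_odd _ (by exact_mod_cast h), neg_smul, Units.neg_smul,
      one_smul, one_smul]

end Grading

/-! ### The extension -/

section Extension

variable {E : Type*} [NormedAddCommGroup E] [NormedSpace ℝ E] {M : Type*} [TopologicalSpace M]
  [ChartedSpace E M] [IsManifold 𝓘(ℝ, E) ∞ M] [FiniteDimensional ℝ E] {a b k : ℕ}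

theorem isLieSuperalgebra_formBracket {φ : Form E M 1} (hφ : extDer φ = 0) (t : ℝ) :
    IsLieSuperalgebra (formGrading E M) (formBracket φ t) where
  isInternal := isInternal_formGrading
  bracket_mem i j x y hx hy := by
    rcases formGrading_cases hx with rfl | ⟨a, rfl, hx'⟩
    · simp
    rcases formGrading_cases hy with rfl | ⟨b, rfl, hy'⟩
    · simp
    rw [show -(a : ℤ) - 1 + (-(b : ℤ) - 1) = -((a + b + 1 : ℕ) : ℤ) - 1 by push_cast; ring,
      formGrading_eq_homogeneous]
    exact formBracket_mem φ t hx' hy'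
  super_symmetry i j x y hx hy := by
    rcases formGrading_cases hx with rfl | ⟨a, rfl, hx'⟩
    · simp
    rcases formGrading_cases hy with rfl | ⟨b, rfl, hy'⟩
    · simp
    rw [negOnePow_smul_eq]
    exact formBracket_swap φ t hx' hy'
  super_jacobi i j k x y z hx hy hz := by
    rcases formGrading_cases hx with rfl | ⟨a, rfl, hx'⟩
    · simp
    rcases formGrading_cases hy with rfl | ⟨b, rfl, hy'⟩
    · simp
    rcases formGrading_cases hz with rfl | ⟨c, rfl, hz'⟩
    · simp
    rw [negOnePow_smul_eq, negOnePow_smul_eq, negOnePow_smul_eq]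
    exact formBracket_jacobi hφ t hx' hy' hz'

variable (φ : Form E M 1) (t : ℝ) (𝔤 : LieSubalgebra ℝ (VectorFields E M))

theorem isLieSuperalgebra_vectorBracket :
    IsLieSuperalgebra (vectorGrading 𝔤) (vectorBracket 𝔤) where
  isInternal := isInternal_vectorGrading 𝔤
  bracket_mem i j X Y hX hY hij := by
    change ⁅X, Y⁆ = 0
    rcases eq_or_ne i 0 with rfl | hi
    · rw [hY (by simpa using hij), lie_zero]
    · rw [hX hi, zero_lie]
  super_symmetry i j X Y hX hY := by
    rcases eq_or_ne i 0 with rfl | hi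
    · change ⁅X, Y⁆ + _ • ⁅Y, X⁆ = 0
      rw [zero_mul, Int.negOnePow_zero, one_smul, ← lie_skew, neg_add_cancel]
    · rw [hX hi]
      simp
  super_jacobi i j k X Y Z hX hY hZ := by
    rcases eq_or_ne i 0 with rfl | hi
    · rcases eq_or_ne j 0 with rfl | hj
      · change _ • ⁅⁅X, Y⁆, Z⁆ + _ • ⁅⁅Y, Z⁆, X⁆ + _ • ⁅⁅Z, X⁆, Y⁆ = 0
        simp only [zero_mul, mul_zero, Int.negOnePow_zero, one_smul]
        have h := lie_jacobi X Y Z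
        rw [← lie_skew X ⁅Y, Z⁆, ← lie_skew Y ⁅Z, X⁆, ← lie_skew Z ⁅X, Y⁆] at h
        rw [← neg_eq_zero, ← h]
        abel
      · rw [hY hj]
        simp
    · rw [hX hi]
      simp

theorem extBracket_apply (u v : AllForms E M × 𝔤) : extBracket φ t 𝔤 u v =
    (formBracket φ t u.1 v.1 + lieAction (u.2 : VectorFields E M) v.1 -
      lieAction (v.2 : VectorFields E M) u.1, ⁅u.2, v.2⁆) := rfl

theorem extBracket_form_form (x y : AllForms E M) :
    extBracket φ t 𝔤 (x, 0) (y, 0) = (formBracket φ t x y, 0) := by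
  simp [extBracket_apply]

theorem extBracket_vector_form (X : 𝔤) (y : AllForms E M) :
    extBracket φ t 𝔤 (0, X) (y, 0) = (lieAction (X : VectorFields E M) y, 0) := by
  simp [extBracket_apply]

theorem extBracket_form_vector (x : AllForms E M) (Y : 𝔤) :
    extBracket φ t 𝔤 (x, 0) (0, Y) = (-lieAction (Y : VectorFields E M) x, 0) := by
  simp [extBracket_apply]

theorem extBracket_vector_vector (X Y : 𝔤) :
    extBracket φ t 𝔤 (0, X) (0, Y) = (0, ⁅X, Y⁆) := by
  simp [extBracket_apply]

variable {φ 𝔤}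

theorem extBracket_jacobi_vector_vector_form (X Y : 𝔤) (z : AllForms E M) :
    extBracket φ t 𝔤 (extBracket φ t 𝔤 (0, X) (0, Y)) (z, 0) +
      extBracket φ t 𝔤 (extBracket φ t 𝔤 (0, Y) (z, 0)) (0, X) +
      extBracket φ t 𝔤 (extBracket φ t 𝔤 (z, 0) (0, X)) (0, Y) = 0 := by
  simp only [extBracket_vector_vector, extBracket_vector_form, extBracket_form_vector,
    LieSubalgebra.coe_bracket, lieAction_lie, map_neg, neg_neg]
  refine Prod.ext ?_ ?_
  · change _ - _ + -_ + _ = (0 : AllForms E M)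
    abel
  · simp

theorem extBracket_jacobi_vector_form_form (h𝔤 : ∀ X ∈ 𝔤, lieDer 1 X φ = 0) (X : 𝔤)
    {y z : AllForms E M} (hy : y ∈ homogeneous E M a) (hz : z ∈ homogeneous E M b) :
    extBracket φ t 𝔤 (extBracket φ t 𝔤 (0, X) (y, 0)) (z, 0) +
      extBracket φ t 𝔤 (extBracket φ t 𝔤 (y, 0) (z, 0)) (0, X) +
      (-1 : ℝ) ^ ((b + 1) * (a + 1)) •
        extBracket φ t 𝔤 (extBracket φ t 𝔤 (z, 0) (0, X)) (y, 0) = 0 := by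
  have h := formBracket_swap φ t hy (lieAction_mem (X : VectorFields E M) hz)
  rw [mul_comm (a + 1)] at h
  simp only [extBracket_form_form, extBracket_vector_form, extBracket_form_vector,
    lieAction_formBracket (h𝔤 X X.2) t hy hz, map_neg, LinearMap.neg_apply]
  refine Prod.ext ?_ ?_
  · change _ + -(_ + _) + _ • (-_) = (0 : AllForms E M)
    rw [smul_neg, ← neg_eq_zero, ← h]
    abel
  · simp

theorem isLieSuperalgebra_extBracket (hφ : extDer φ = 0) (h𝔤 : ∀ X ∈ 𝔤, lieDer 1 X φ = 0) :
    IsLieSuperalgebra (extGrading 𝔤) (extBracket φ t 𝔤) where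
  isInternal := isInternal_extGrading 𝔤
  bracket_mem i j u v hu hv := by
    rcases extGrading_cases 𝔤 hu with rfl | ⟨rfl, X, rfl⟩ | ⟨a, rfl, x, hx, rfl⟩
    · simp
    all_goals rcases extGrading_cases 𝔤 hv with rfl | ⟨rfl, Y, rfl⟩ | ⟨b, rfl, y, hy, rfl⟩
    · simp
    · rw [extBracket_vector_vector]
      exact ⟨zero_mem _, fun h => absurd (add_zero _) h⟩
    · rw [extBracket_vector_form, zero_add]
      refine ⟨?_, zero_mem _⟩
      rw [formGrading_eq_homogeneous]
      exact lieAction_mem _ hy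
    · simp
    · rw [extBracket_form_vector, add_zero]
      refine ⟨?_, zero_mem _⟩
      rw [formGrading_eq_homogeneous]
      exact neg_mem (lieAction_mem _ hx)
    · rw [extBracket_form_form]
      rw [← formGrading_eq_homogeneous] at hx hy
      exact ⟨(isLieSuperalgebra_formBracket hφ t).bracket_mem _ _ x y hx hy, zero_mem _⟩
  super_symmetry i j u v hu hv := by
    rcases extGrading_cases 𝔤 hu with rfl | ⟨rfl, X, rfl⟩ | ⟨a, rfl, x, hx, rfl⟩
    · simp
    all_goals rcases extGrading_cases 𝔤 hv with rfl | ⟨rfl, Y, rfl⟩ | ⟨b, rfl, y, hy, rfl⟩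
    · simp
    · rw [extBracket_vector_vector, extBracket_vector_vector, zero_mul, Int.negOnePow_zero,
        one_smul]
      refine Prod.ext (by simp) ?_
      change ⁅X, Y⁆ + ⁅Y, X⁆ = 0
      rw [← lie_skew, neg_add_cancel]
    · rw [extBracket_vector_form, extBracket_form_vector, zero_mul, Int.negOnePow_zero, one_smul]
      simp
    · simp
    · rw [extBracket_vector_form, extBracket_form_vector, mul_zero, Int.negOnePow_zero, one_smul]
      simp
    · rw [extBracket_form_form, extBracket_form_form, negOnePow_smul_eq]
      exact Prod.ext (formBracket_swap φ t hx hy) (by simp)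
  super_jacobi i j k u v w hu hv hw := by
    rcases extGrading_cases 𝔤 hu with rfl | ⟨rfl, X, rfl⟩ | ⟨a, rfl, x, hx, rfl⟩
    · simp
    all_goals rcases extGrading_cases 𝔤 hv with rfl | ⟨rfl, Y, rfl⟩ | ⟨b, rfl, y, hy, rfl⟩
    · simp
    · rcases extGrading_cases 𝔤 hw with rfl | ⟨rfl, Z, rfl⟩ | ⟨c, rfl, z, hz, rfl⟩
      · simp
      · simp only [extBracket_vector_vector]
        have h := (isLieSuperalgebra_vectorBracket 𝔤).super_jacobi 0 0 0 X Y Z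
          (fun h => absurd rfl h) (fun h => absurd rfl h) (fun h => absurd rfl h)
        exact Prod.ext (by simp) h
      · simp only [zero_mul, mul_zero, Int.negOnePow_zero, one_smul]
        exact extBracket_jacobi_vector_vector_form t X Y z
    · rcases extGrading_cases 𝔤 hw with rfl | ⟨rfl, Z, rfl⟩ | ⟨c, rfl, z, hz, rfl⟩
      · simp
      · simp only [zero_mul, mul_zero, Int.negOnePow_zero, one_smul]
        rw [← extBracket_jacobi_vector_vector_form t Z X y]
        abel
      · simp only [zero_mul, mul_zero, Int.negOnePow_zero, one_smul, negOnePow_smul_eq]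
        exact extBracket_jacobi_vector_form_form t h𝔤 X hy hz
    · simp
    · rcases extGrading_cases 𝔤 hw with rfl | ⟨rfl, Z, rfl⟩ | ⟨c, rfl, z, hz, rfl⟩
      · simp
      · simp only [zero_mul, mul_zero, Int.negOnePow_zero, one_smul]
        rw [← extBracket_jacobi_vector_vector_form t Y Z x]
        abel
      · simp only [zero_mul, mul_zero, Int.negOnePow_zero, one_smul, negOnePow_smul_eq]
        rw [← extBracket_jacobi_vector_form_form t h𝔤 Y hz hx]
        abel
    · rcases extGrading_cases 𝔤 hw with rfl | ⟨rfl, Z, rfl⟩ | ⟨c, rfl, z, hz, rfl⟩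
      · simp
      · simp only [zero_mul, mul_zero, Int.negOnePow_zero, one_smul, negOnePow_smul_eq]
        rw [← extBracket_jacobi_vector_form_form t h𝔤 Z hx hy]
        abel
      · simp only [extBracket_form_form, negOnePow_smul_eq]
        exact Prod.ext (formBracket_jacobi hφ t hx hy hz) (by simp)

end Extension

end DeformedForms

theorem mainTheorem5 {E : Type*} [NormedAddCommGroup E] [NormedSpace ℝ E] [FiniteDimensional ℝ E]
    {M : Type*} [TopologicalSpace M] [ChartedSpace E M] [IsManifold 𝓘(ℝ, E) ∞ M]
    (φ : Form E M 1) (hφ : extDer φ = 0) :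
    ∃ 𝔤 : LieSubalgebra ℝ (VectorFields E M),
      (𝔤 : Set (VectorFields E M)) = {X | lieDer 1 X φ = 0} ∧
      ∀ t : ℝ, IsLieSuperalgebraExtension
        (formGrading E M) (formBracket φ t)
        (extGrading 𝔤) (extBracket φ t 𝔤)
        (vectorGrading 𝔤) (vectorBracket 𝔤)
        (LinearMap.inl ℝ (AllForms E M) 𝔤) (LinearMap.snd ℝ (AllForms E M) 𝔤) := by
  let 𝔤 : LieSubalgebra ℝ (VectorFields E M) :=
    { LinearMap.ker ((lieDer 1).flip φ) with
      lie_mem' := by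
        intro X Y (hX : lieDer 1 X φ = 0) (hY : lieDer 1 Y φ = 0)
        change lieDer 1 ⁅X, Y⁆ φ = 0
        rw [lieDer_lie, hX, hY, map_zero, map_zero, sub_zero] }
  refine ⟨𝔤, rfl, fun t => ?_⟩
  exact
    { kernel := isLieSuperalgebra_formBracket hφ t
      total := isLieSuperalgebra_extBracket t hφ fun _ hX => hX
      quotient := isLieSuperalgebra_vectorBracket 𝔤
      map_bracket_left := fun x y => (extBracket_form_form φ t 𝔤 x y).symm
      map_bracket_right := fun _ _ => rfl
      map_mem_left := fun _ _ hx => ⟨hx, zero_mem _⟩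
      map_mem_right := fun _ _ hx => hx.2
      injective := LinearMap.inl_injective
      exact_mid := Function.Exact.inl_snd
      surjective := LinearMap.snd_surjective }
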